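/- All systems are finite-dimensional with a fixed standard basis. For a Hermitian operator $H$ (a Hamiltonian) and a fixed inverse temperature $\beta\in\mathbb{R}$, the thermal state is $\gamma=e^{-\beta H}/\operatorname{tr}[e^{-\beta H}]$, and non-interacting systems have the sum of their Hamiltonians as total Hamiltonian. A thermal operation on a system $X$ with Hamiltonian $H_X$ is a map of the form $\Phi(\cdot)=\operatorname{tr}_B[U((\cdot)\otimes\gamma_B)U^\dagger]$, where $B$ is any bath system with any Hamiltonian $H_B$ and thermal state $\gamma_B$, and $U$ is a unitary on $XB$ with $[U,H_X+H_B]=0$. An information battery $J$ is a system with $H_J=0$; its battery states are $\tau_J^m=P_J^m/\operatorname{tr}[P_J^m]$ with $P_J^m$ an orthogonal projector of rank $e^m$. The effective work process of a map $\Phi$ on $XJ$ with respect to battery states $(\tau_J^m,\tau_J^{m'})$ is $\mathcal{T}(\cdot)=\operatorname{tr}_J[P_J^{m'}\,\Phi((\cdot)\otimes\tau_J^m)]$. The fidelity is $F(\rho,\sigma)=\|\sqrt\rho\sqrt\sigma\|_1$. For a state $\sigma_S$, a set $\mathcal{S}$ of states on $SM$ and $\delta'\ge 0$, a universal conditional $\delta'$-erasure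 process of $S$ to $\sigma_S$ using $M$ as side information, for the set $\mathcal{S}$, is a completely positive, trace non-increasing map $\mathcal{T}_{SM\to SM}$ such that for every $\rho_{SM}\in\mathcal{S}$ and every purification $|\rho\rangle_{SMR}$ of $\rho_{SM}$ on any finite-dimensional reference system $R$, $F\big(\mathcal{T}(\rho_{SMR}),\sigma_S\otimes\rho_{MR}\big)\ge 1-\delta'$. **Proposition.** Let $S,M$ be systems with Hamiltonians $H_S,H_M$, and let $\gamma_S$ be the thermal state of $S$ at inverse temperature $\beta$. Let $\mathcal{S}_{SM}$ be an arbitrary set of states on $S\otimes M$. Let $m\ge 0$ be such that $e^m$ is an integer. Let $P_{SM}$ be a Hermitian operator with $0\le P_{SM}\le \mathbb{1}$ and $[P_{SM},H_S+H_M]=0$, and let $\kappa,\kappa'\ge 0$ be such that for all $\rho_{SM}\in\mathcal{S}_{SM}$ $$\operatorname{tr}[P_{SM}\,\rho_{SM}]\ge 1-\kappa,\qquad \operatorname{tr}[P_{SM}(\gamma_S\otimes\rho_M)]\le \frac{\kappa'}{e^m}.$$ Then there exist an information battery $J$ with a standard basis state $|0\rangle_J$ and a battery state $\tau_J^m$,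 and a thermal operation $\mathcal{R}_{SMJ\to SMJ}$ (at inverse temperature $\beta$), such that the effective work process $\mathcal{T}_{SM\to SM}$ of $\mathcal{R}_{SMJ\to SMJ}$ with respect to the battery states $(\tau_J^m,|0\rangle\langle 0|_J)$ is a universal conditional $(2\kappa+4\kappa')$-erasure process of $S$ to $\gamma_S$, using $M$ as side information, for the set of states $\mathcal{S}'_{SM}$, where $\mathcal{S}'_{SM}$ is the convex hull of $\mathcal{S}_{SM}$. -/

import Mathlib

open scoped Matrix Kronecker MatrixOrder ComplexOrder

universe u

namespace QThermo

noncomputable section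

/-! A quantum system is a finite type `X` indexing its standard basis; operators on it are the
matrices `Matrix X X ℂ`, and the composite of the systems `X` and `Y` is `X × Y`. -/

/-- Quantum states (density operators). -/
def IsState {X : Type u} [Fintype X] (ρ : Matrix X X ℂ) : Prop :=
  ρ.PosSemidef ∧ ρ.trace = 1

/-- `|ψ⟩⟨ψ|`. -/
def ketBra {X : Type*} (ψ : X → ℂ) : Matrix X X ℂ := Matrix.vecMulVec ψ (star ψ)

/-- Partial trace over the second tensor factor. -/
def traceSnd {X Y : Type*} [Fintype Y] (A : Matrix (X × Y) (X × Y) ℂ) : Matrix X X ℂ :=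
  Matrix.of fun x x' => ∑ y, A (x, y) (x', y)

/-- Partial trace over the first tensor factor. -/
def traceFst {X Y : Type*} [Fintype X] (A : Matrix (X × Y) (X × Y) ℂ) : Matrix Y Y ℂ :=
  Matrix.of fun y y' => ∑ x, A (x, y) (x, y')

/-- Total Hamiltonian `H_X ⊗ 1 + 1 ⊗ H_Y` of two non-interacting systems. -/
def totalHamiltonian {X Y : Type*} [DecidableEq X] [DecidableEq Y]
    (HX : Matrix X X ℂ) (HY : Matrix Y Y ℂ) : Matrix (X × Y) (X × Y) ℂ :=
  HX ⊗ₖ (1 : Matrix Y Y ℂ) + (1 : Matrix X X ℂ) ⊗ₖ HY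

/-- Gibbs state `e^{-β H} / tr e^{-β H}`. -/
def gibbsState {X : Type*} [Fintype X] [DecidableEq X] (β : ℝ) (H : Matrix X X ℂ) :
    Matrix X X ℂ :=
  (NormedSpace.exp ((-β : ℂ) • H)).trace⁻¹ • NormedSpace.exp ((-β : ℂ) • H)

/-- `T ⊗ id_R` for a linear map `T` on the operators on `X`. -/
def extendById {X : Type*} (R : Type*) (T : Matrix X X ℂ →ₗ[ℂ] Matrix X X ℂ)
    (A : Matrix (X × R) (X × R) ℂ) : Matrix (X × R) (X × R) ℂ :=
  Matrix.of fun i j => T (Matrix.of fun x x' => A (x, i.2) (x', j.2)) i.1 j.1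

/-- The unnormalized maximally entangled ket `∑ₖ |k⟩ ⊗ |k⟩` of `X` and a copy of `X`. -/
def maxEntangledKet (X : Type*) [DecidableEq X] : X × X → ℂ :=
  fun i => if i.1 = i.2 then 1 else 0

/-- Complete positivity: `T` preserves Hermiticity and maps the maximally entangled reference
operator to a positive semidefinite operator. -/
def IsCompletelyPositive {X : Type*} [Fintype X] [DecidableEq X]
    (T : Matrix X X ℂ →ₗ[ℂ] Matrix X X ℂ) : Prop :=
  (∀ A : Matrix X X ℂ, A.IsHermitian → (T A).IsHermitian) ∧
    (extendById X T (ketBra (maxEntangledKet X))).PosSemidef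

/-- `T` does not increase the trace of positive semidefinite operators. -/
def IsTraceNonincreasing {X : Type*} [Fintype X]
    (T : Matrix X X ℂ →ₗ[ℂ] Matrix X X ℂ) : Prop :=
  ∀ A : Matrix X X ℂ, A.PosSemidef → (T A).trace.re ≤ A.trace.re

/-- The one-norm `tr √(A† A)`. -/
def oneNorm {X : Type*} [Fintype X] [DecidableEq X] (A : Matrix X X ℂ) : ℝ :=
  (CFC.sqrt (Aᴴ * A)).trace.re

/-- The (non-squared) fidelity `‖√ρ √σ‖₁`. -/
def fidelity {X : Type*} [Fintype X] [DecidableEq X] (ρ σ : Matrix X X ℂ) : ℝ :=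
  oneNorm (CFC.sqrt ρ * CFC.sqrt σ)

/-- Thermal operations at inverse temperature `β` on a system with Hamiltonian `H`: the maps
`ρ ↦ tr_B [U (ρ ⊗ γ_B) U†]`, with a bath system `B`, any Hamiltonian `H_B` on it, and any unitary
`U` commuting with the total Hamiltonian. -/
def IsThermalOperation {X : Type u} [Fintype X] [DecidableEq X] (β : ℝ) (H : Matrix X X ℂ)
    (Φ : Matrix X X ℂ →ₗ[ℂ] Matrix X X ℂ) : Prop :=
  ∃ (B : Type u) (_ : Fintype B) (_ : DecidableEq B) (_ : Nonempty B)
    (HB : Matrix B B ℂ) (U : Matrix (X × B) (X × B) ℂ),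
    HB.IsHermitian ∧ U ∈ Matrix.unitaryGroup (X × B) ℂ ∧
      Commute U (totalHamiltonian H HB) ∧
      ∀ A : Matrix X X ℂ, Φ A = traceSnd (U * (A ⊗ₖ gibbsState β HB) * Uᴴ)

/-- `P` is an orthogonal projector of rank `e^m` on the information battery `W`. -/
def IsBatteryProjector {W : Type*} [Fintype W] (m : ℝ) (P : Matrix W W ℂ) : Prop :=
  P.IsHermitian ∧ P * P = P ∧ (P.rank : ℝ) = Real.exp m

/-- The battery state `P / tr P` of a projector `P`. -/
def batteryState {W : Type*} [Fintype W] (P : Matrix W W ℂ) : Matrix W W ℂ :=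
  P.trace⁻¹ • P

/-- The effective work process `A ↦ tr_W [P' Φ(A ⊗ τ)]`, with `τ = P / tr P`, of a map `Φ` on
the system `X` and the information battery `W`; the battery states are given through their
projectors `P` (input) and `P'` (output). -/
def effectiveWorkProcess {X W : Type*} [Fintype X] [DecidableEq X] [Fintype W]
    (Φ : Matrix (X × W) (X × W) ℂ →ₗ[ℂ] Matrix (X × W) (X × W) ℂ) (P P' : Matrix W W ℂ) :
    Matrix X X ℂ →ₗ[ℂ] Matrix X X ℂ where
  toFun A := traceSnd (((1 : Matrix X X ℂ) ⊗ₖ P') * Φ (A ⊗ₖ batteryState P))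
  map_add' A B := by
    ext x x'
    simp [traceSnd, Matrix.add_kronecker, Matrix.mul_add, Finset.sum_add_distrib]
  map_smul' c A := by
    ext x x'
    simp [traceSnd, Matrix.smul_kronecker, Finset.mul_sum]

/-- `T` is a universal conditional `δ`-erasure process of `S` to the state `σ`, using `M` as
side information, for the set `𝒮` of states on `S ⊗ M`: for every `ρ ∈ 𝒮` and every purification
`ψ` of `ρ` on a reference system `R`, `F(T(ρ_SMR), σ_S ⊗ ρ_MR) ≥ 1 - δ`. -/
def IsUniversalConditionalErasure {S M : Type u} [Fintype S] [DecidableEq S] [Fintype M]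
    [DecidableEq M] (σ : Matrix S S ℂ) (𝒮 : Set (Matrix (S × M) (S × M) ℂ)) (δ : ℝ)
    (T : Matrix (S × M) (S × M) ℂ →ₗ[ℂ] Matrix (S × M) (S × M) ℂ) : Prop :=
  IsCompletelyPositive T ∧ IsTraceNonincreasing T ∧
    ∀ ρ ∈ 𝒮, ∀ (R : Type u) [Fintype R] [DecidableEq R] (ψ : (S × M) × R → ℂ),
      traceSnd (ketBra ψ) = ρ →
        1 - δ ≤ fidelity (extendById R T (ketBra ψ))
          (Matrix.reindex (Equiv.prodAssoc S M R).symm (Equiv.prodAssoc S M R).symm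
            (σ ⊗ₖ traceFst (Matrix.reindex (Equiv.prodAssoc S M R) (Equiv.prodAssoc S M R)
              (ketBra ψ))))

end

end QThermo

open QThermo

/-! The proof is position-based decoding, made coherent by a single reflection. Write `e^m = N`. The
bath is `N` copies of the thermal system `S`; the battery has basis `none` (the state `|0⟩`) and
`some j`, and starts uniformly mixed over the `some j`. Conditioned on `j`, a unitary `V j`
exchanges `S` with the `j`-th copy. Tracing out the bath leaves exactly `γ_S ⊗ ρ_M`, so erasure is
already perfect; what remains is to return the battery from `j` to `none` without disturbing the
rest.

The position `j` can be read off: the test `P_j = V j (P ⊗ 1) (V j)†` accepts position `j` with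
probability at least `1 - κ`. For `i ≠ j`, undoing `V i` after `V j` still leaves `γ_S ⊗ ρ_M` on
`SM`, so `P_i` accepts with probability at most `κ'/N`. Put `y = (1 + ∑ P_i²)⁻¹`. The Householder
reflection along the column `(1, -P_1, …, -P_N)` is unitary, preserves energy because `P` does, and
has block `2 y P_j` from `some j` to `none`; the factor 2 makes it the identity when `P_j = 1` and
the other tests vanish.

By Uhlmann (`re_trace_conjTranspose_mul_le_fidelity`), the fidelity is at least the overlap of Kraus
purifications of the actual and the ideal process, which is the average over `j` of `Re tr[2 y P_j
ω_j]` with `ω_j = V j (ρ ⊗ γ) (V j)†`. The operator inequality `posSemidef_decoder_bound` bounds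
each term below by `1 - κ - κ'/2`, more than is required. Both conditions on `P` are affine in `ρ`,
so they pass to the convex hull before anything else is done. -/

namespace QThermo

set_option linter.unusedSectionVars false

/-! ### Fidelity and overlaps of purifications -/

section Fidelity

variable {n k : Type*} [Fintype n] [DecidableEq n] [Fintype k]

theorem trace_mul_re_nonneg {A B : Matrix n n ℂ} (hA : A.PosSemidef) (hB : B.PosSemidef) :
    0 ≤ (A * B).trace.re := by
  obtain ⟨C, rfl⟩ := CStarAlgebra.nonneg_iff_eq_star_mul_self.mp hB.nonneg
  rw [← Matrix.mul_assoc, Matrix.trace_mul_comm, ← Matrix.mul_assoc]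
  exact (Complex.le_def.mp (hA.mul_mul_conjTranspose_same C).trace_nonneg).1

theorem trace_mul_re_le {A A' B : Matrix n n ℂ} (hA : (A' - A).PosSemidef)
    (hB : B.PosSemidef) : (A * B).trace.re ≤ (A' * B).trace.re := by
  have := trace_mul_re_nonneg hA hB
  rw [Matrix.sub_mul, Matrix.trace_sub, Complex.sub_re] at this
  linarith

/-- A Hermitian matrix has a Hermitian pseudo-inverse. -/
theorem exists_pseudoinverse {s : Matrix n n ℂ} (hs : s.IsHermitian) :
    ∃ q : Matrix n n ℂ, q.IsHermitian ∧ s * q * s = s ∧ q * s = s * q := by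
  have hc (f : ℝ → ℝ) : ContinuousOn f (spectrum ℝ s) :=
    (Matrix.finite_real_spectrum (A := s)).continuousOn f
  have hs' : IsSelfAdjoint s := hs
  refine ⟨cfc (fun x : ℝ => x⁻¹) s, cfc_predicate _ s, ?_, ?_⟩
  · have e : cfc (fun x : ℝ => x * x⁻¹ * x) s = s := by
      rw [cfc_congr (g := fun x => x) (fun x _ => by simp), cfc_id' ℝ s]
    rw [cfc_mul _ _ s (hc _) (hc _), cfc_mul _ _ s (hc _) (hc _), cfc_id' ℝ s] at e
    exact e
  · have e := cfc_commute_cfc (fun x : ℝ => x⁻¹) (fun x => x) s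
    rw [cfc_id' ℝ s] at e
    exact e

/-- If `X X† = s²` with `s` Hermitian, then `X = s V` for a contraction `V`. -/
theorem exists_contraction {s : Matrix n n ℂ} (hs : s.IsHermitian) (X : Matrix n k ℂ)
    (h : X * Xᴴ = s * s) :
    ∃ V : Matrix n k ℂ, X = s * V ∧ (1 - V * Vᴴ).PosSemidef := by
  obtain ⟨q, hq, h1, h2⟩ := exists_pseudoinverse hs
  have hqc : qᴴ = q := hq
  have hsc : sᴴ = s := hs
  -- With `q` the pseudo-inverse of `s`, `V V†` is the projector `s q` onto the range of `s`, and
  -- the part of `X` outside that range vanishes because `X X† = s²`.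
  refine ⟨q * X, ?_, ?_⟩
  · have h0 : (X - s * (q * X)) * (X - s * (q * X))ᴴ = 0 := by
      have e : X - s * (q * X) = (1 - s * q) * X := by
        rw [Matrix.sub_mul, Matrix.one_mul, Matrix.mul_assoc]
      rw [e, Matrix.conjTranspose_mul, Matrix.mul_assoc, ← Matrix.mul_assoc X, h]
      rw [← Matrix.mul_assoc, ← Matrix.mul_assoc (1 - s * q), Matrix.sub_mul, Matrix.one_mul, h1]
      simp
    exact (sub_eq_zero.mp (Matrix.self_mul_conjTranspose_eq_zero.mp h0))
  · have e : 1 - (q * X) * (q * X)ᴴ = (1 - s * q) * (1 - s * q)ᴴ := by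
      have e1 : (q * X) * (q * X)ᴴ = q * s * (s * q) := by
        rw [Matrix.conjTranspose_mul, hqc, Matrix.mul_assoc, ← Matrix.mul_assoc X, h]
        simp only [Matrix.mul_assoc]
      have e2 : s * q * (s * q) = s * q := by rw [← Matrix.mul_assoc, h1]
      rw [e1, h2, e2, Matrix.conjTranspose_sub, Matrix.conjTranspose_one,
        Matrix.conjTranspose_mul, hqc, hsc, h2, Matrix.mul_sub, Matrix.sub_mul, Matrix.sub_mul, e2]
      simp
    rw [e]
    exact Matrix.posSemidef_self_mul_conjTranspose _

/-- Expand `0 ≤ tr[(A - B)(A - B)† h]`: the two squares contribute at most `2 tr h`, and the cross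
terms are complex conjugates of each other. -/
theorem trace_mul_re_le_trace {h : Matrix n n ℂ} (hh : h.PosSemidef) {A B : Matrix n k ℂ}
    (hA : (1 - A * Aᴴ).PosSemidef) (hB : (1 - B * Bᴴ).PosSemidef) :
    (A * Bᴴ * h).trace.re ≤ h.trace.re := by
  have h0 := trace_mul_re_nonneg (Matrix.posSemidef_self_mul_conjTranspose (A - B)) hh
  have h1 := trace_mul_re_nonneg hA hh
  have h2 := trace_mul_re_nonneg hB hh
  have h3 : (B * Aᴴ * h).trace.re = (A * Bᴴ * h).trace.re := by
    have e : (A * Bᴴ * h).trace = star (B * Aᴴ * h).trace := by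
      rw [← Matrix.trace_conjTranspose, Matrix.conjTranspose_mul, Matrix.conjTranspose_mul,
        Matrix.conjTranspose_conjTranspose, hh.isHermitian.eq, Matrix.trace_mul_comm]
    rw [e]
    rfl
  simp only [Matrix.conjTranspose_sub, Matrix.sub_mul, Matrix.mul_sub, Matrix.one_mul,
    Matrix.trace_sub, Complex.sub_re] at h0 h1 h2
  linarith

/-- Lower bound half of Uhlmann's theorem: the overlap of purifications is at most the fidelity. -/
theorem re_trace_conjTranspose_mul_le_fidelity (X Z : Matrix n k ℂ) :
    (Zᴴ * X).trace.re ≤ fidelity (X * Xᴴ) (Z * Zᴴ) := by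
  have hX := (Matrix.posSemidef_self_mul_conjTranspose X).nonneg
  have hZ := (Matrix.posSemidef_self_mul_conjTranspose Z).nonneg
  unfold fidelity oneNorm
  set s := CFC.sqrt (X * Xᴴ) with hs
  set t := CFC.sqrt (Z * Zᴴ) with ht
  have hsH : s.IsHermitian := (Matrix.nonneg_iff_posSemidef.mp (CFC.sqrt_nonneg _)).isHermitian
  have htH : t.IsHermitian := (Matrix.nonneg_iff_posSemidef.mp (CFC.sqrt_nonneg _)).isHermitian
  obtain ⟨V, hV, hV1⟩ := exists_contraction hsH X (CFC.sqrt_mul_sqrt_self _ hX).symm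
  obtain ⟨W, hW, hW1⟩ := exists_contraction htH Z (CFC.sqrt_mul_sqrt_self _ hZ).symm
  have hC := (Matrix.posSemidef_conjTranspose_mul_self (s * t)).nonneg
  set h := CFC.sqrt ((s * t)ᴴ * (s * t)) with hh
  have hP : h.PosSemidef := Matrix.nonneg_iff_posSemidef.mp (CFC.sqrt_nonneg _)
  obtain ⟨Y, hY, hY1⟩ := exists_contraction hP.isHermitian (s * t)ᴴ
    (by rw [Matrix.conjTranspose_conjTranspose]; exact (CFC.sqrt_mul_sqrt_self _ hC).symm)
  have hYV : (1 - (Y * V) * (Y * V)ᴴ).PosSemidef := by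
    have e : 1 - (Y * V) * (Y * V)ᴴ = (1 - Y * Yᴴ) + Y * (1 - V * Vᴴ) * Yᴴ := by
      simp only [Matrix.conjTranspose_mul, Matrix.mul_sub, Matrix.sub_mul, Matrix.mul_one,
        Matrix.mul_assoc]
      abel
    rw [e]
    exact hY1.add (hV1.mul_mul_conjTranspose_same Y)
  -- Since `X = s V`, `Z = t W` and `t s = (s t)† = h Y`, the overlap is `tr[W† h Y V]`, with `W`
  -- and `Y V` contractions and `tr h` the fidelity.
  refine le_trans (le_of_eq ?_) (trace_mul_re_le_trace hP hW1 hYV)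
  have e : (Zᴴ * X).trace = star (W * (Y * V)ᴴ * h).trace := by
    rw [← Matrix.trace_conjTranspose]
    have e1 : (W * (Y * V)ᴴ * h)ᴴ = (s * t)ᴴ * (V * Wᴴ) := by
      rw [hY]
      simp only [Matrix.conjTranspose_mul, Matrix.conjTranspose_conjTranspose,
        hP.isHermitian.eq, Matrix.mul_assoc]
    rw [e1, Matrix.conjTranspose_mul, htH.eq, hsH.eq, Matrix.mul_assoc, Matrix.trace_mul_comm t]
    rw [Matrix.trace_mul_comm]
    conv_lhs => rw [hW, hV]
    simp only [Matrix.conjTranspose_mul, htH.eq, Matrix.mul_assoc]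
  rw [e]
  rfl

end Fidelity

/-! ### The decoder inequality and the Householder reflection -/

section Decoder

variable {Y ι : Type*} [Fintype Y] [DecidableEq Y] [Fintype ι]

theorem posDef_one_add_sum_sq {P : ι → Matrix Y Y ℂ} (hP : ∀ j, (P j).IsHermitian) :
    (1 + ∑ i, P i * P i).PosDef := by
  refine Matrix.PosDef.one.add_posSemidef (Matrix.posSemidef_sum _ fun i _ => ?_)
  have := Matrix.posSemidef_conjTranspose_mul_self (P i)
  rwa [(hP i).eq] at this

/-- With `y = (1 + T)⁻¹`, one has `1 - y = y (T + T²) y`. -/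
theorem posSemidef_one_sub_inv {T : Matrix Y Y ℂ} (hT : T.PosSemidef) :
    (1 - (1 + T)⁻¹).PosSemidef := by
  have hZ : (1 + T).PosDef := Matrix.PosDef.one.add_posSemidef hT
  have hu := (Matrix.isUnit_iff_isUnit_det _).mp hZ.isUnit
  have h1 := Matrix.mul_nonsing_inv _ hu
  have h2 := Matrix.nonsing_inv_mul _ hu
  have hY : ((1 + T)⁻¹).IsHermitian := hZ.isHermitian.inv
  set y := (1 + T)⁻¹
  have e : 1 - y = y * (T + Tᴴ * T) * yᴴ := by
    rw [hY.eq, hT.isHermitian.eq]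
    have e1 : T + T * T = T * (1 + T) := by noncomm_ring
    rw [e1, Matrix.mul_assoc, Matrix.mul_assoc, h1, Matrix.mul_one]
    calc 1 - y = y * (1 + T) - y := by rw [h2]
      _ = y * T := by noncomm_ring
  rw [e]
  exact (hT.add (Matrix.posSemidef_conjTranspose_mul_self T)).mul_mul_conjTranspose_same y

/-- A quadratic refinement of the Hayashi–Nagaoka inequality, for amplitudes. -/
theorem posSemidef_decoder_bound {a T : Matrix Y Y ℂ} (ha : a.IsHermitian) (hT : T.PosSemidef) :
    ((2 : ℂ) • ((1 + T)⁻¹ * a) + (2 : ℂ) • (a * (1 + T)⁻¹) -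
      ((2 : ℂ) • (1 - (1 - a) * (1 - a)) - (T - a * a))).PosSemidef := by
  have hZ : (1 + T).PosDef := Matrix.PosDef.one.add_posSemidef hT
  have hu := (Matrix.isUnit_iff_isUnit_det _).mp hZ.isUnit
  have h1 := Matrix.mul_nonsing_inv _ hu
  have h2 := Matrix.nonsing_inv_mul _ hu
  have hY := hZ.inv.posSemidef
  have hY1 := posSemidef_one_sub_inv hT
  set y := (1 + T)⁻¹
  have h3 : T * y = 1 - y := by rw [← h1]; noncomm_ring
  have h4 : y * T = 1 - y := by rw [← h2]; noncomm_ring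
  have k1 := hY.mul_mul_conjTranspose_same (T - a)
  have k2 := hY1.mul_mul_conjTranspose_same (1 - a)
  have hTa : (T - a)ᴴ = T - a := by
    rw [Matrix.conjTranspose_sub, hT.isHermitian.eq, ha.eq]
  have h1a : (1 - a)ᴴ = 1 - a := by
    rw [Matrix.conjTranspose_sub, Matrix.conjTranspose_one, ha.eq]
  rw [hTa] at k1
  rw [h1a] at k2
  have e : (T - a) * y * (T - a) = T - 1 + y - a + y * a - a + a * y + a * y * a := by
    calc (T - a) * y * (T - a) = (T * y) * T - (T * y) * a - a * (y * T) + a * y * a := by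
          noncomm_ring
      _ = T - y * T - a + y * a - a + a * y + a * y * a := by rw [h3, h4]; noncomm_ring; rw [h4]; noncomm_ring
      _ = _ := by rw [h4]; noncomm_ring
  -- The whole inequality is this identity: the difference is a sum of two congruences, of `y` by `T
  -- - a` and of `1 - y` by `1 - a`.
  have e' : (2 : ℂ) • (y * a) + (2 : ℂ) • (a * y) -
      ((2 : ℂ) • (1 - (1 - a) * (1 - a)) - (T - a * a)) =
      (T - a) * y * (T - a) + (1 - a) * (1 - y) * (1 - a) := by
    rw [e, two_smul, two_smul, two_smul]
    noncomm_ring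
  rw [e']
  exact k1.add k2

/-- `y P_j` and `P_j y` have the same real trace against the Hermitian `ω`, so the operator bound
controls `4 Re tr[y P_j ω]`. Halving it leaves weight `1/2` on the false acceptances. -/
theorem re_trace_decoder {P : ι → Matrix Y Y ℂ} [DecidableEq ι] (hP : ∀ j, (P j).IsHermitian)
    {ω : Matrix Y Y ℂ} (hω : ω.PosSemidef) (j : ι) :
    ω.trace.re - ((1 - P j) * (1 - P j) * ω).trace.re
        - (∑ i ∈ Finset.univ.erase j, (P i * P i * ω).trace.re) / 2 ≤
      ((2 : ℂ) • (1 + ∑ i, P i * P i)⁻¹ * P j * ω).trace.re := by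
  have hT : (∑ i, P i * P i).PosSemidef := Matrix.posSemidef_sum _ fun i _ => by
    have := Matrix.posSemidef_conjTranspose_mul_self (P i)
    rwa [(hP i).eq] at this
  have hZ : (1 + ∑ i, P i * P i).PosDef := Matrix.PosDef.one.add_posSemidef hT
  have h := trace_mul_re_nonneg (posSemidef_decoder_bound (hP j) hT) hω
  have hy := hZ.inv.isHermitian
  set y := (1 + ∑ i, P i * P i)⁻¹
  have hs : ∑ i, P i * P i - P j * P j = ∑ i ∈ Finset.univ.erase j, P i * P i := by
    rw [← Finset.add_sum_erase _ _ (Finset.mem_univ j)]; abel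
  rw [hs] at h
  have e : (P j * y * ω).trace.re = (y * P j * ω).trace.re := by
    have : (P j * y * ω).trace = star (y * P j * ω).trace := by
      rw [← Matrix.trace_conjTranspose, Matrix.conjTranspose_mul, Matrix.conjTranspose_mul,
        hω.isHermitian.eq, (hP j).eq, hy.eq, Matrix.trace_mul_comm]
    rw [this]
    rfl
  simp only [Matrix.add_mul, Matrix.sub_mul, Matrix.smul_mul, Matrix.sum_mul, Matrix.trace_add,
    Matrix.trace_sub, Matrix.trace_smul, Matrix.trace_sum, Complex.add_re, Complex.sub_re,
    Complex.re_sum, smul_eq_mul, Complex.mul_re, Complex.re_ofNat, Complex.im_ofNat, zero_mul,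
    sub_zero, Matrix.one_mul, e, Matrix.mul_sub, Matrix.mul_one] at h ⊢
  linarith

/-- Here `y = (c† c)⁻¹`, so `c y c†` is the orthogonal projector onto the range of `c`, and one
minus twice a projector is a reflection. -/
theorem householder_mem_unitaryGroup {W : Type*} [Fintype W] [DecidableEq W]
    {c : Matrix W Y ℂ} {y : Matrix Y Y ℂ} (hy : y.IsHermitian) (h : y * (cᴴ * c) = 1) :
    1 - (2 : ℂ) • (c * y * cᴴ) ∈ Matrix.unitaryGroup W ℂ := by
  rw [Matrix.mem_unitaryGroup_iff]
  have e : star (1 - (2 : ℂ) • (c * y * cᴴ)) = 1 - (2 : ℂ) • (c * y * cᴴ) := by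
    rw [Matrix.star_eq_conjTranspose]
    simp [Matrix.conjTranspose_mul, hy.eq, Matrix.mul_assoc]
  have e2 : c * y * cᴴ * (c * y * cᴴ) = c * y * cᴴ := by
    calc c * y * cᴴ * (c * y * cᴴ) = c * (y * (cᴴ * c)) * y * cᴴ := by
          simp only [Matrix.mul_assoc]
      _ = _ := by rw [h, Matrix.mul_one]
  rw [e, two_smul]
  generalize c * y * cᴴ = q at e2
  calc (1 - (q + q)) * (1 - (q + q)) = 1 - 4 • q + 4 • (q * q) := by noncomm_ring
    _ = 1 := by rw [e2]; noncomm_ring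

end Decoder


/-! ### Energy-preserving operators controlled by the battery -/

section Controlled

variable {X B J : Type*} [Fintype X] [DecidableEq X] [Fintype B] [DecidableEq B]
  [Fintype J] [DecidableEq J]

/-- The operator `∑ₐ V a ⊗ |a⟩⟨a|`, controlled by the system `J`. -/
def controlled (V : J → Matrix (X × B) (X × B) ℂ) :
    Matrix ((X × J) × B) ((X × J) × B) ℂ :=
  Matrix.of fun i j => if i.1.2 = j.1.2 then V i.1.2 (i.1.1, i.2) (j.1.1, j.2) else 0

/-- The operator `∑ₐ C a ⊗ |a⟩`. -/
def stacked (C : J → Matrix (X × B) (X × B) ℂ) : Matrix ((X × J) × B) (X × B) ℂ :=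
  Matrix.of fun i j => C i.1.2 (i.1.1, i.2) j

theorem controlled_mul_controlled (V W : J → Matrix (X × B) (X × B) ℂ) :
    controlled V * controlled W = controlled fun a => V a * W a := by
  ext ⟨⟨x, a⟩, b⟩ ⟨⟨x', a'⟩, b'⟩
  simp only [controlled, Matrix.mul_apply, Matrix.of_apply, Fintype.sum_prod_type]
  rcases eq_or_ne a a' with rfl | h
  · simp
  · simp [h]

theorem conjTranspose_controlled (V : J → Matrix (X × B) (X × B) ℂ) :
    (controlled V)ᴴ = controlled fun a => (V a)ᴴ := by
  ext ⟨⟨x, a⟩, b⟩ ⟨⟨x', a'⟩, b'⟩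
  by_cases h : a = a'
  · subst h; simp [controlled]
  · simp [controlled, h, Ne.symm h]

theorem controlled_one : controlled (fun _ : J => (1 : Matrix (X × B) (X × B) ℂ)) = 1 := by
  ext ⟨⟨x, a⟩, b⟩ ⟨⟨x', a'⟩, b'⟩
  simp only [controlled, Matrix.of_apply, Matrix.one_apply, Prod.mk.injEq]
  grind

theorem controlled_mul_stacked (V C : J → Matrix (X × B) (X × B) ℂ) :
    controlled V * stacked C = stacked fun a => V a * C a := by
  ext ⟨⟨x, a⟩, b⟩ j
  simp [controlled, stacked, Matrix.mul_apply, Fintype.sum_prod_type]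

theorem conjTranspose_stacked_mul_controlled (C V : J → Matrix (X × B) (X × B) ℂ) :
    (stacked C)ᴴ * controlled V = (stacked fun a => (V a)ᴴ * C a)ᴴ := by
  rw [← controlled_mul_stacked, Matrix.conjTranspose_mul, conjTranspose_controlled]
  simp

theorem stacked_mul (C : J → Matrix (X × B) (X × B) ℂ) (A : Matrix (X × B) (X × B) ℂ) :
    stacked C * A = stacked fun a => C a * A := by
  ext ⟨⟨x, a⟩, b⟩ j
  simp [stacked, Matrix.mul_apply]

theorem conjTranspose_stacked_mul_stacked (C : J → Matrix (X × B) (X × B) ℂ) :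
    (stacked C)ᴴ * stacked C = ∑ a, (C a)ᴴ * C a := by
  ext i j
  simp only [stacked, Matrix.mul_apply, Matrix.sum_apply, Matrix.conjTranspose_apply,
    Matrix.of_apply, Fintype.sum_prod_type]
  rw [Finset.sum_comm]

/-- The battery is degenerate, so every branch sees the same Hamiltonian and energy conservation of
a controlled operator can be checked branch by branch. -/
theorem totalHamiltonian_eq_controlled (HX : Matrix X X ℂ) (HB : Matrix B B ℂ) :
    totalHamiltonian (totalHamiltonian HX (0 : Matrix J J ℂ)) HB =
      controlled fun _ => totalHamiltonian HX HB := by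
  ext ⟨⟨x, a⟩, b⟩ ⟨⟨x', a'⟩, b'⟩
  by_cases h : a = a'
  · subst h; simp [totalHamiltonian, controlled, Matrix.one_apply]
  · simp [totalHamiltonian, controlled, Matrix.one_apply, h]

theorem controlled_mem_unitaryGroup {V : J → Matrix (X × B) (X × B) ℂ}
    (hV : ∀ a, V a ∈ Matrix.unitaryGroup (X × B) ℂ) :
    controlled V ∈ Matrix.unitaryGroup ((X × J) × B) ℂ := by
  rw [Matrix.mem_unitaryGroup_iff, Matrix.star_eq_conjTranspose, conjTranspose_controlled,
    controlled_mul_controlled, ← controlled_one]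
  congr 1
  ext1 a
  exact Matrix.mem_unitaryGroup_iff.mp (hV a)

/-- A coherent decoder: given Hermitian tests `P j` and unitaries `V j` preserving energy, there is
an energy-preserving unitary whose block from `some j` to `none` is `2 (1 + ∑ᵢ Pᵢ²)⁻¹ Pⱼ Vⱼ`. -/
theorem exists_decoder_unitary {ι : Type*} [Fintype ι] [DecidableEq ι]
    {HX : Matrix X X ℂ} {HB : Matrix B B ℂ} {P V : ι → Matrix (X × B) (X × B) ℂ}
    (hP : ∀ j, (P j).IsHermitian) (hPc : ∀ j, Commute (P j) (totalHamiltonian HX HB))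
    (hV : ∀ j, V j ∈ Matrix.unitaryGroup (X × B) ℂ)
    (hVc : ∀ j, Commute (V j) (totalHamiltonian HX HB)) :
    ∃ U : Matrix ((X × Option ι) × B) ((X × Option ι) × B) ℂ,
      U ∈ Matrix.unitaryGroup _ ℂ ∧
      Commute U (totalHamiltonian (totalHamiltonian HX (0 : Matrix (Option ι) (Option ι) ℂ)) HB) ∧
      ∀ x b j x' b', U ((x, none), b) ((x', some j), b') =
        ((2 : ℂ) • (1 + ∑ i, P i * P i)⁻¹ * P j * V j) (x, b) (x', b') := by
  have hZ := posDef_one_add_sum_sq hP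
  have hu := (Matrix.isUnit_iff_isUnit_det _).mp hZ.isUnit
  have h2 := Matrix.nonsing_inv_mul _ hu
  have hyH := hZ.inv.isHermitian
  set H := totalHamiltonian HX HB with hH
  have hyc : Commute (1 + ∑ i, P i * P i)⁻¹ H := by
    have : Commute (1 + ∑ i, P i * P i) H :=
      (Commute.one_left H).add_left (Commute.sum_left _ _ _ fun i _ => (hPc i).mul_left (hPc i))
    have h1 := Matrix.mul_nonsing_inv _ hu
    set y := (1 + ∑ i, P i * P i)⁻¹
    calc y * H = y * (H * ((1 + ∑ i, P i * P i) * y)) := by rw [h1, Matrix.mul_one]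
      _ = y * ((1 + ∑ i, P i * P i) * H) * y := by
        rw [this.eq]; simp only [Matrix.mul_assoc]
      _ = H * y := by rw [← Matrix.mul_assoc, h2, Matrix.one_mul]
  set y := (1 + ∑ i, P i * P i)⁻¹
  -- The column of the reflection. The minus sign cancels the one in `1 - 2 c y c†`, so that the
  -- block from `some j` to `none` is positive `2 y P_j`.
  set C : Option ι → Matrix (X × B) (X × B) ℂ := fun a => a.elim 1 fun j => -P j with hC
  have hCH : ∀ a, (C a)ᴴ = C a := by
    rintro (_ | j)
    · simp [hC]
    · simp [hC, (hP j).eq]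
  have hCc : ∀ a, Commute (C a) H := by
    rintro (_ | j)
    · exact Commute.one_left _
    · exact (hPc j).neg_left
  -- The controlled exchange precedes the reflection; the branch `none` is never populated
  -- initially, so the identity serves there.
  set W : Option ι → Matrix (X × B) (X × B) ℂ := fun a => a.elim 1 V with hW
  have hWu : ∀ a, W a ∈ Matrix.unitaryGroup (X × B) ℂ := by
    rintro (_ | j)
    · exact one_mem _
    · exact hV j
  have hWc : ∀ a, Commute (W a) H := by
    rintro (_ | j)
    · exact Commute.one_left _
    · exact hVc j
  have hc : y * ((stacked C)ᴴ * stacked C) = 1 := by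
    rw [conjTranspose_stacked_mul_stacked, Fintype.sum_option, ← h2]
    congr 2
    · simp [hC]
    · simp [hC, (hP _).eq]
  have hR := householder_mem_unitaryGroup hyH hc
  have hcH : controlled (fun _ : Option ι => H) * stacked C = stacked C * H := by
    rw [controlled_mul_stacked, stacked_mul]
    congr 1
    ext1 a
    exact (hCc a).eq.symm
  have hcH' : (stacked C)ᴴ * controlled (fun _ : Option ι => H) = H * (stacked C)ᴴ := by
    have e : H * (stacked C)ᴴ = (stacked C * Hᴴ)ᴴ := by
      rw [Matrix.conjTranspose_mul, Matrix.conjTranspose_conjTranspose]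
    rw [conjTranspose_stacked_mul_controlled, e, stacked_mul]
    congr 2
    ext1 a
    rw [← hCH a, ← Matrix.conjTranspose_mul, hCH a, (hCc a).eq, Matrix.conjTranspose_mul, hCH a]
  refine ⟨(1 - (2 : ℂ) • (stacked C * y * (stacked C)ᴴ)) * controlled W,
    mul_mem hR (controlled_mem_unitaryGroup hWu), ?_, ?_⟩
  · rw [totalHamiltonian_eq_controlled]
    refine Commute.mul_left ((Commute.one_left _).sub_left (Commute.smul_left ?_ _)) ?_
    · calc stacked C * y * (stacked C)ᴴ * controlled (fun _ : Option ι => H)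
          = stacked C * (y * H) * (stacked C)ᴴ := by
            rw [Matrix.mul_assoc, hcH']; simp only [Matrix.mul_assoc]
        _ = stacked C * H * y * (stacked C)ᴴ := by
            rw [hyc.eq]; simp only [Matrix.mul_assoc]
        _ = _ := by rw [← hcH, hH]; simp only [Matrix.mul_assoc]
    · change controlled W * _ = _ * controlled W
      rw [controlled_mul_controlled, controlled_mul_controlled]
      congr 1
      ext1 a
      exact (hWc a).eq
  · intro x b j x' b'
    have hst : stacked C * y * (stacked C)ᴴ * controlled W =
        stacked (fun a => C a * y) * (stacked fun a => (W a)ᴴ * C a)ᴴ := by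
      rw [← conjTranspose_stacked_mul_controlled, ← stacked_mul, Matrix.mul_assoc]
    have hst' : (stacked (fun a => C a * y) * (stacked fun a => (W a)ᴴ * C a)ᴴ)
        ((x, none), b) ((x', some j), b') = (y * -(P j) * V j) (x, b) (x', b') := by
      have : y * -(P j) * V j = (C none * y) * ((W (some j))ᴴ * C (some j))ᴴ := by
        simp [hC, hW, (hP j).eq, Matrix.mul_assoc]
      rw [this]
      rfl
    rw [Matrix.sub_mul, Matrix.smul_mul, hst, Matrix.sub_apply, Matrix.smul_apply, hst']
    simp [controlled]

end Controlled

/-! ### Kraus families and purified outputs -/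

section Kraus

variable {X K R : Type*} [Fintype X] [DecidableEq X] [Fintype K] [Fintype R] [DecidableEq R]

/-- The vectors `(A k ⊗ 1) ψ`, as the columns of a matrix. -/
def krausColumns (A : K → Matrix X X ℂ) (ψ : X × R → ℂ) : Matrix (X × R) K ℂ :=
  Matrix.of fun i k => ∑ y, A k i.1 y * ψ (y, i.2)

theorem extendById_ketBra_of_kraus {T : Matrix X X ℂ →ₗ[ℂ] Matrix X X ℂ} {A : K → Matrix X X ℂ}
    (hT : ∀ ω, T ω = ∑ k, A k * ω * (A k)ᴴ) (ψ : X × R → ℂ) :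
    extendById R T (ketBra ψ) = krausColumns A ψ * (krausColumns A ψ)ᴴ := by
  ext ⟨x, r⟩ ⟨x', r'⟩
  simp only [extendById, hT, Matrix.of_apply, Matrix.sum_apply, Matrix.mul_apply, krausColumns,
    ketBra, Matrix.vecMulVec_apply, Matrix.conjTranspose_apply, star_sum, star_mul', Pi.star_apply,
    Finset.sum_mul, Finset.mul_sum]
  refine Finset.sum_congr rfl fun k _ => Finset.sum_congr rfl fun y _ =>
    Finset.sum_congr rfl fun y' _ => ?_
  ring

/-- The reference enters the overlap only through the reduced state, which is why one bound serves
all purifications. -/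
theorem trace_krausColumns_mul (A A' : K → Matrix X X ℂ) (ψ : X × R → ℂ) :
    ((krausColumns A' ψ)ᴴ * krausColumns A ψ).trace =
      (∑ k, A k * traceSnd (ketBra ψ) * (A' k)ᴴ).trace := by
  rw [Matrix.trace_mul_comm, Matrix.trace_sum]
  simp only [Matrix.trace, Matrix.diag_apply, Matrix.of_apply, Matrix.mul_apply, krausColumns,
    traceSnd, ketBra, Matrix.vecMulVec_apply, Matrix.conjTranspose_apply, star_sum, star_mul',
    Pi.star_apply, Finset.sum_mul, Finset.mul_sum, Fintype.sum_prod_type]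
  rw [Finset.sum_congr rfl fun x _ => Finset.sum_comm, Finset.sum_comm]
  refine Finset.sum_congr rfl fun k _ => Finset.sum_congr rfl fun x _ => ?_
  rw [Finset.sum_comm]
  refine Finset.sum_congr rfl fun y' _ => ?_
  rw [Finset.sum_comm]
  refine Finset.sum_congr rfl fun y _ => Finset.sum_congr rfl fun r _ => ?_
  ring

theorem isCompletelyPositive_of_kraus {T : Matrix X X ℂ →ₗ[ℂ] Matrix X X ℂ}
    {A : K → Matrix X X ℂ} (hT : ∀ ω, T ω = ∑ k, A k * ω * (A k)ᴴ) :
    IsCompletelyPositive T := by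
  refine ⟨fun ω hω => ?_, ?_⟩
  · rw [hT]
    rw [Matrix.IsHermitian, Matrix.conjTranspose_sum]
    exact Finset.sum_congr rfl fun k _ => Matrix.isHermitian_mul_mul_conjTranspose _ hω
  · rw [extendById_ketBra_of_kraus hT]
    exact Matrix.posSemidef_self_mul_conjTranspose _

end Kraus

/-! ### The battery projector -/

section Battery

variable {ι : Type*} [Fintype ι] [DecidableEq ι]

/-- The projector onto the span of the basis states `some j`. -/
def someProjector (ι : Type*) [DecidableEq ι] : Matrix (Option ι) (Option ι) ℂ :=
  Matrix.diagonal fun a => a.elim 0 fun _ => 1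

theorem trace_someProjector : (someProjector ι).trace = Fintype.card ι := by
  simp [someProjector, Matrix.trace]

theorem isBatteryProjector_someProjector {m : ℝ} (hm : Real.exp m = Fintype.card ι) :
    IsBatteryProjector m (someProjector ι) := by
  refine ⟨?_, ?_, ?_⟩
  · refine Matrix.isHermitian_diagonal_iff.mpr ?_
    rintro (_ | j) <;> simp
  · rw [someProjector, Matrix.diagonal_mul_diagonal]
    congr 1
    ext (_ | j) <;> simp
  · rw [hm, someProjector, Matrix.rank_diagonal, Nat.cast_inj]
    refine (Fintype.card_congr ?_).symm
    exact
      { toFun := fun j => ⟨some j, by simp⟩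
        invFun := fun a => a.1.get (by rcases a with ⟨_ | j, h⟩; exacts [absurd rfl h, rfl])
        left_inv := fun j => by simp
        right_inv := fun a => by rcases a with ⟨_ | j, h⟩; exacts [absurd rfl h, rfl] }

end Battery

/-! ### Kraus form of the effective work process -/

section WorkProcess

variable {X B ι : Type*} [Fintype X] [DecidableEq X] [Fintype B] [DecidableEq B]
  [Fintype ι] [DecidableEq ι]

theorem effectiveWorkProcess_apply_apply {J : Type*} [Fintype J] [DecidableEq J]
    (Φ : Matrix (X × J) (X × J) ℂ →ₗ[ℂ] Matrix (X × J) (X × J) ℂ) (P : Matrix J J ℂ) (j₀ : J)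
    (A : Matrix X X ℂ) (x x' : X) :
    effectiveWorkProcess Φ P (ketBra (Pi.single j₀ 1)) A x x' =
      Φ (A ⊗ₖ batteryState P) (x, j₀) (x', j₀) := by
  have h : ketBra (Pi.single j₀ (1 : ℂ)) = Matrix.single j₀ j₀ 1 := by
    ext a b
    simp [ketBra, Matrix.vecMulVec_apply, Matrix.single_apply, Pi.single_apply]
    grind
  simp [effectiveWorkProcess, traceSnd, Matrix.mul_apply, Fintype.sum_prod_type, h,
    Matrix.single_apply, Matrix.one_apply, ite_and]

/-- `A ↦ tr_B [U (A ⊗ γ) U†]`. -/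
def dilatedMap (γ : Matrix B B ℂ) (U : Matrix (X × B) (X × B) ℂ) :
    Matrix X X ℂ →ₗ[ℂ] Matrix X X ℂ where
  toFun A := traceSnd (U * (A ⊗ₖ γ) * Uᴴ)
  map_add' A A' := by
    ext x x'
    simp [traceSnd, Matrix.add_kronecker, Matrix.mul_add, Matrix.add_mul, Finset.sum_add_distrib]
  map_smul' c A := by
    ext x x'
    simp [traceSnd, Matrix.smul_kronecker, Finset.mul_sum]

theorem trace_traceSnd (A : Matrix (X × B) (X × B) ℂ) : (traceSnd A).trace = A.trace := by
  simp [traceSnd, Matrix.trace, Fintype.sum_prod_type]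

theorem trace_dilatedMap {γ : Matrix B B ℂ} (hγ : γ.trace = 1) {U : Matrix (X × B) (X × B) ℂ}
    (hU : U ∈ Matrix.unitaryGroup (X × B) ℂ) (A : Matrix X X ℂ) :
    (dilatedMap γ U A).trace = A.trace := by
  have := Matrix.mem_unitaryGroup_iff'.mp hU
  rw [Matrix.star_eq_conjTranspose] at this
  change (traceSnd _).trace = _
  rw [trace_traceSnd, Matrix.trace_mul_comm, ← Matrix.mul_assoc, this, Matrix.one_mul,
    Matrix.trace_kronecker, hγ, mul_one]

theorem dilatedMap_posSemidef {γ : Matrix B B ℂ} (hγ : γ.PosSemidef) (U : Matrix (X × B) (X × B) ℂ)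
    {A : Matrix X X ℂ} (hA : A.PosSemidef) : (dilatedMap γ U A).PosSemidef := by
  have h := (hA.kronecker hγ).mul_mul_conjTranspose_same U
  have e : dilatedMap γ U A = ∑ b, (U * (A ⊗ₖ γ) * Uᴴ).submatrix (·, b) (·, b) := by
    ext x x'
    simp [dilatedMap, traceSnd, Matrix.sum_apply]
  rw [e]
  exact Matrix.posSemidef_sum _ fun b _ => h.submatrix _

/-- Projecting the battery on `j₀` keeps some of the nonnegative diagonal entries of an operator
whose trace is that of the input. -/
theorem isTraceNonincreasing_effectiveWorkProcess {J : Type*} [Fintype J] [DecidableEq J]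
    {γ : Matrix B B ℂ} (hγ : γ.PosSemidef) (hγ1 : γ.trace = 1)
    {U : Matrix ((X × J) × B) ((X × J) × B) ℂ} (hU : U ∈ Matrix.unitaryGroup _ ℂ)
    {P : Matrix J J ℂ} (hP : (batteryState P).PosSemidef) (hP1 : (batteryState P).trace = 1)
    (j₀ : J) :
    IsTraceNonincreasing (effectiveWorkProcess (dilatedMap γ U) P (ketBra (Pi.single j₀ 1))) := by
  intro A hA
  have h := dilatedMap_posSemidef hγ U (hA.kronecker hP)
  have e : (dilatedMap γ U (A ⊗ₖ batteryState P)).trace = A.trace := by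
    rw [trace_dilatedMap hγ1 hU, Matrix.trace_kronecker, hP1, mul_one]
  rw [← e]
  simp only [Matrix.trace, Matrix.diag_apply, effectiveWorkProcess_apply_apply, Complex.re_sum,
    Fintype.sum_prod_type]
  refine Finset.sum_le_sum fun x _ => ?_
  exact Finset.single_le_sum (f := fun j => (dilatedMap γ U (A ⊗ₖ batteryState P) (x, j) (x, j)).re)
    (fun j _ => (Complex.le_def.mp h.diag_nonneg).1) (Finset.mem_univ j₀)

theorem batteryState_someProjector :
    batteryState (someProjector ι) =
      Matrix.diagonal fun a => a.elim 0 fun _ => ((Fintype.card ι : ℝ)⁻¹ : ℂ) := by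
  rw [batteryState, trace_someProjector, someProjector, ← Matrix.diagonal_smul]
  congr 1
  ext (_ | j) <;> simp

theorem batteryState_someProjector_posSemidef : (batteryState (someProjector ι)).PosSemidef := by
  rw [batteryState_someProjector]
  refine Matrix.PosSemidef.diagonal ?_
  rintro (_ | j)
  · simp
  · simp

theorem batteryState_someProjector_trace [Nonempty ι] :
    (batteryState (someProjector ι)).trace = 1 := by
  rw [batteryState_someProjector]
  simp [Matrix.trace]

theorem traceSnd_mul_kronecker_diagonal_apply (p : B → ℂ) (U U' : Matrix (X × B) (X × B) ℂ)
    (A : Matrix X X ℂ) (x x' : X) :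
    traceSnd (U * (A ⊗ₖ Matrix.diagonal p) * U'ᴴ) x x' =
      ∑ b, ∑ y', ∑ c, ∑ y, p c * (U (x, b) (y, c) * A y y' * star (U' (x', b) (y', c))) := by
  simp only [traceSnd, Matrix.of_apply,
    Matrix.mul_apply, Matrix.kroneckerMap_apply, Fintype.sum_prod_type, Matrix.conjTranspose_apply,
    Matrix.diagonal_apply, mul_ite, mul_zero, Finset.sum_ite_eq', Finset.mem_univ, if_true,
    Finset.sum_mul]
  refine Finset.sum_congr rfl fun b _ => Finset.sum_congr rfl fun y' _ =>
    Finset.sum_congr rfl fun c _ => Finset.sum_congr rfl fun y _ => ?_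
  ring

/-- Kraus operators `√(p c / |ι|) ⟨b| G j |c⟩`. -/
noncomputable def krausOp (p : B → ℝ) (G : ι → Matrix (X × B) (X × B) ℂ) (k : B × ι × B) :
    Matrix X X ℂ :=
  Matrix.of fun x y => (√(p k.2.2 * (Fintype.card ι : ℝ)⁻¹) : ℂ) * G k.2.1 (x, k.1) (y, k.2.2)

/-- Two families are allowed: `G = G'` gives the processes themselves, and `G ≠ G'` the overlap
between the actual and the ideal one. -/
theorem sum_krausOp {p : B → ℝ} (hp : ∀ c, 0 ≤ p c) (G G' : ι → Matrix (X × B) (X × B) ℂ)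
    (A : Matrix X X ℂ) :
    ∑ k, krausOp p G k * A * (krausOp p G' k)ᴴ =
      ((Fintype.card ι : ℝ)⁻¹ : ℂ) •
        ∑ j, traceSnd (G j * (A ⊗ₖ Matrix.diagonal fun c => (p c : ℂ)) * (G' j)ᴴ) := by
  ext x x'
  rw [Matrix.sum_apply, Matrix.smul_apply, Matrix.sum_apply]
  simp only [traceSnd_mul_kronecker_diagonal_apply, Fintype.sum_prod_type, Matrix.mul_apply,
    Matrix.conjTranspose_apply, krausOp, Matrix.of_apply, Finset.sum_mul, Finset.mul_sum,
    smul_eq_mul]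
  rw [Finset.sum_comm]
  refine Finset.sum_congr rfl fun j _ => Finset.sum_congr rfl fun b _ => ?_
  rw [Finset.sum_comm]
  refine Finset.sum_congr rfl fun y' _ => Finset.sum_congr rfl fun c _ =>
    Finset.sum_congr rfl fun y _ => ?_
  have h : ((√(p c * (Fintype.card ι : ℝ)⁻¹) : ℝ) : ℂ) * (√(p c * (Fintype.card ι : ℝ)⁻¹) : ℝ) =
      p c * ((Fintype.card ι : ℝ)⁻¹ : ℝ) := by
    rw [← Complex.ofReal_mul, Real.mul_self_sqrt (mul_nonneg (hp c) (by positivity)),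
      Complex.ofReal_mul]
  rw [star_mul', Complex.star_def, Complex.conj_ofReal, ← Complex.star_def]
  rw [← Complex.ofReal_inv]
  linear_combination (G j (x, b) (y, c) * A y y' * star (G' j (x', b) (y', c))) * h

/-- The battery enters in a mixture of the `some j` and leaves in `none`, so only these blocks of
`U` matter. -/
theorem effectiveWorkProcess_dilatedMap {p : B → ℝ} (hp : ∀ c, 0 ≤ p c)
    (U : Matrix ((X × Option ι) × B) ((X × Option ι) × B) ℂ)
    (G : ι → Matrix (X × B) (X × B) ℂ)
    (hG : ∀ x b j x' b', U ((x, none), b) ((x', some j), b') = G j (x, b) (x', b'))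
    (A : Matrix X X ℂ) :
    effectiveWorkProcess (dilatedMap (Matrix.diagonal fun c => (p c : ℂ)) U) (someProjector ι)
      (ketBra (Pi.single none 1)) A = ∑ k, krausOp p G k * A * (krausOp p G k)ᴴ := by
  rw [sum_krausOp hp]
  ext x x'
  rw [effectiveWorkProcess_apply_apply, batteryState_someProjector]
  change traceSnd (U * _ * Uᴴ) _ _ = _
  rw [Matrix.smul_apply, Matrix.sum_apply]
  simp only [traceSnd_mul_kronecker_diagonal_apply, Fintype.sum_prod_type, Fintype.sum_option,
    Matrix.kroneckerMap_apply, Matrix.diagonal_apply, hG, Option.elim_none, Option.elim_some,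
    mul_zero, zero_mul, Finset.sum_const_zero, zero_add, mul_ite,
    ite_mul, Finset.sum_ite_eq', Finset.mem_univ, if_true, Finset.mul_sum, smul_eq_mul]
  symm
  rw [Finset.sum_comm]
  refine Finset.sum_congr rfl fun b _ => ?_
  rw [Finset.sum_comm]
  refine Finset.sum_congr rfl fun y' _ => Finset.sum_congr rfl fun j _ =>
    Finset.sum_congr rfl fun c _ => Finset.sum_congr rfl fun y _ => ?_
  push_cast
  ring

end WorkProcess

/-! ### Error bound for position-based decoding -/

section Core

variable {X B : Type*} [Fintype X] [DecidableEq X] [Fintype B] [DecidableEq B]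

theorem trace_kronecker_one_mul (A : Matrix X X ℂ) (Q : Matrix (X × B) (X × B) ℂ) :
    ((A ⊗ₖ (1 : Matrix B B ℂ)) * Q).trace = (A * traceSnd Q).trace := by
  simp only [Matrix.trace, Matrix.diag_apply, Matrix.mul_apply, Matrix.kroneckerMap_apply, traceSnd,
    Matrix.of_apply, Fintype.sum_prod_type, Matrix.one_apply, mul_ite, mul_one, mul_zero, ite_mul,
    zero_mul, Finset.sum_ite_eq, Finset.mem_univ, if_true, Finset.mul_sum]
  exact Finset.sum_congr rfl fun x _ => Finset.sum_comm

/-- `P - P²` splits as `(1 - P) P (1 - P) + P (1 - P) P`. -/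
theorem posSemidef_sub_mul_self {P : Matrix X X ℂ} (hP : P.PosSemidef)
    (hP1 : (1 - P).PosSemidef) : (P - P * P).PosSemidef := by
  have h1 := hP.mul_mul_conjTranspose_same (1 - P)
  have h2 := hP1.mul_mul_conjTranspose_same P
  rw [hP1.isHermitian.eq] at h1
  rw [hP.isHermitian.eq] at h2
  have e : P - P * P = (1 - P) * P * (1 - P) + P * (1 - P) * P := by noncomm_ring
  rw [e]
  exact h1.add h2

variable {ι : Type*} [Fintype ι] [DecidableEq ι] [Nonempty ι]

/-- Decoding error of the tests `V j (P ⊗ 1) (V j)†` in the states `V j (ρ ⊗ γ) (V j)†`. -/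
theorem le_re_trace_decoder {P : Matrix X X ℂ} (hP : P.PosSemidef) (hP1 : (1 - P).PosSemidef)
    {V : ι → Matrix (X × B) (X × B) ℂ} (hV : ∀ j, V j ∈ Matrix.unitaryGroup (X × B) ℂ)
    {γ : Matrix B B ℂ} (hγ : γ.PosSemidef) (hγ1 : γ.trace = 1) {ρ : Matrix X X ℂ}
    (hρ : IsState ρ) {κ κ' : ℝ} (hκ' : 0 ≤ κ') (h1 : 1 - κ ≤ (P * ρ).trace.re)
    (h2 : ∀ i j, i ≠ j →
      (P * dilatedMap γ ((V i)ᴴ * V j) ρ).trace.re ≤ κ' / Fintype.card ι) (j : ι) :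
    1 - κ - κ' / 2 ≤
      ((2 : ℂ) • (1 + ∑ i, V i * (P ⊗ₖ 1) * (V i)ᴴ * (V i * (P ⊗ₖ 1) * (V i)ᴴ))⁻¹ *
        (V j * (P ⊗ₖ 1) * (V j)ᴴ) * (V j * (ρ ⊗ₖ γ) * (V j)ᴴ)).trace.re := by
  have hVl : ∀ j, (V j)ᴴ * V j = 1 := fun j => Matrix.mem_unitaryGroup_iff'.mp (hV j)
  have hVr : ∀ j, V j * (V j)ᴴ = 1 := fun j => Matrix.mem_unitaryGroup_iff.mp (hV j)
  have hPH : (P ⊗ₖ (1 : Matrix B B ℂ)).IsHermitian :=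
    (hP.kronecker Matrix.PosSemidef.one).isHermitian
  have hω : (V j * (ρ ⊗ₖ γ) * (V j)ᴴ).PosSemidef :=
    (hρ.1.kronecker hγ).mul_mul_conjTranspose_same _
  refine le_trans ?_ (re_trace_decoder
    (P := fun i => V i * (P ⊗ₖ (1 : Matrix B B ℂ)) * (V i)ᴴ)
    (fun i => Matrix.isHermitian_mul_mul_conjTranspose _ hPH) hω j)
  have cyc : ∀ (i : ι) (A : Matrix (X × B) (X × B) ℂ),
      (V i * A * (V i)ᴴ * (V j * (ρ ⊗ₖ γ) * (V j)ᴴ)).trace =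
        (A * (((V i)ᴴ * V j) * (ρ ⊗ₖ γ) * ((V i)ᴴ * V j)ᴴ)).trace := by
    intro i A
    rw [Matrix.mul_assoc, Matrix.mul_assoc (V i), Matrix.trace_mul_comm, Matrix.conjTranspose_mul,
      Matrix.conjTranspose_conjTranspose]
    simp only [Matrix.mul_assoc]
  have e0 : (V j * (ρ ⊗ₖ γ) * (V j)ᴴ).trace = 1 := by
    rw [Matrix.trace_mul_comm, ← Matrix.mul_assoc, hVl, Matrix.one_mul, Matrix.trace_kronecker,
      hρ.2, hγ1, mul_one]
  have sq : ∀ i, ∀ A : Matrix X X ℂ, V i * (A ⊗ₖ (1 : Matrix B B ℂ)) * (V i)ᴴ *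
      (V i * (A ⊗ₖ (1 : Matrix B B ℂ)) * (V i)ᴴ) =
        V i * ((A * A) ⊗ₖ (1 : Matrix B B ℂ)) * (V i)ᴴ := by
    intro i A
    calc _ = V i * (A ⊗ₖ (1 : Matrix B B ℂ)) * ((V i)ᴴ * V i) *
          (A ⊗ₖ (1 : Matrix B B ℂ)) * (V i)ᴴ := by simp only [Matrix.mul_assoc]
      _ = _ := by
        rw [hVl, Matrix.mul_one, Matrix.mul_assoc (V i), ← Matrix.mul_kronecker_mul, Matrix.one_mul]
  have e1 : 1 - V j * (P ⊗ₖ (1 : Matrix B B ℂ)) * (V j)ᴴ =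
      V j * ((1 - P) ⊗ₖ (1 : Matrix B B ℂ)) * (V j)ᴴ := by
    have : (1 - P) ⊗ₖ (1 : Matrix B B ℂ) = 1 - P ⊗ₖ (1 : Matrix B B ℂ) := by
      rw [eq_sub_iff_add_eq, ← Matrix.add_kronecker, sub_add_cancel, Matrix.one_kronecker_one]
    rw [this, Matrix.mul_sub, Matrix.sub_mul, Matrix.mul_one, hVr]
  have b1 : ((1 - V j * (P ⊗ₖ (1 : Matrix B B ℂ)) * (V j)ᴴ) *
      (1 - V j * (P ⊗ₖ (1 : Matrix B B ℂ)) * (V j)ᴴ) *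
        (V j * (ρ ⊗ₖ γ) * (V j)ᴴ)).trace.re ≤ κ := by
    have ht : traceSnd (ρ ⊗ₖ γ) = ρ := by
      ext x x'
      have : ∑ b, γ b b = 1 := hγ1
      simp [traceSnd, ← Finset.mul_sum, this]
    rw [e1, sq, cyc, hVl, Matrix.conjTranspose_one, Matrix.one_mul, Matrix.mul_one,
      trace_kronecker_one_mul, ht]
    -- The bound involves squares of effects; `(1 - P)² ≤ 1 - P` here, and `P² ≤ P` for the false
    -- acceptances, reduce it to the given probabilities.
    have := trace_mul_re_le (posSemidef_sub_mul_self hP1 (by simpa using hP)) hρ.1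
    refine this.trans ?_
    rw [Matrix.sub_mul, Matrix.one_mul, Matrix.trace_sub, hρ.2, Complex.sub_re, Complex.one_re]
    linarith
  have b2 : ∑ i ∈ Finset.univ.erase j, (V i * (P ⊗ₖ (1 : Matrix B B ℂ)) * (V i)ᴴ *
      (V i * (P ⊗ₖ (1 : Matrix B B ℂ)) * (V i)ᴴ) *
        (V j * (ρ ⊗ₖ γ) * (V j)ᴴ)).trace.re ≤ κ' := by
    have hc : (0 : ℝ) < Fintype.card ι := by exact_mod_cast Fintype.card_pos
    calc _ ≤ ∑ i ∈ Finset.univ.erase j, κ' / Fintype.card ι := by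
          refine Finset.sum_le_sum fun i hi => ?_
          rw [sq, cyc, trace_kronecker_one_mul]
          refine le_trans (trace_mul_re_le (posSemidef_sub_mul_self hP hP1) ?_)
            (h2 i j (Finset.ne_of_mem_erase hi))
          exact dilatedMap_posSemidef hγ _ hρ.1
      -- Adding back the term `i = j` makes the sum exactly `κ'`.
      _ ≤ ∑ i : ι, κ' / Fintype.card ι :=
          Finset.sum_le_sum_of_subset_of_nonneg (Finset.erase_subset _ _)
            fun _ _ _ => by positivity
      _ = κ' := by
          rw [Finset.sum_const, Finset.card_univ, nsmul_eq_mul]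
          field_simp
  rw [e0]
  simp only [Complex.one_re]
  linarith

end Core

/-! ### From exchange unitaries to an erasure process -/

section Erasure

variable {S M B : Type u} [Fintype S] [DecidableEq S] [Fintype M] [DecidableEq M]
  [Fintype B] [DecidableEq B]

/-- The target is itself an output: the uniform mixture of the exchanges without decoding sends
`ρ_SMR` to `σ ⊗ ρ_MR`. Its Kraus family has the same index set as that of `T`, so the two outputs
have purifications whose overlap is the average of the decoder traces. -/
theorem le_fidelity_extendById {ι : Type*} [Fintype ι] [DecidableEq ι] [Nonempty ι]
    {σ : Matrix S S ℂ} {p : B → ℝ} (hp : ∀ c, 0 ≤ p c)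
    {V E : ι → Matrix ((S × M) × B) ((S × M) × B) ℂ}
    (hV : ∀ j A, dilatedMap (Matrix.diagonal fun c => (p c : ℂ)) (V j) A = σ ⊗ₖ traceFst A)
    {T : Matrix (S × M) (S × M) ℂ →ₗ[ℂ] Matrix (S × M) (S × M) ℂ}
    (hT : ∀ A, T A = ∑ k, krausOp p (fun j => E j * V j) k * A *
      (krausOp p (fun j => E j * V j) k)ᴴ)
    {δ : ℝ} {R : Type u} [Fintype R] [DecidableEq R] (ψ : (S × M) × R → ℂ)
    (hδ : ∀ j, 1 - δ ≤ (E j * (V j * (traceSnd (ketBra ψ) ⊗ₖ Matrix.diagonal fun c => (p c : ℂ)) *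
      (V j)ᴴ)).trace.re) :
    1 - δ ≤ fidelity (extendById R T (ketBra ψ))
      (Matrix.reindex (Equiv.prodAssoc S M R).symm (Equiv.prodAssoc S M R).symm
        (σ ⊗ₖ traceFst (Matrix.reindex (Equiv.prodAssoc S M R) (Equiv.prodAssoc S M R)
          (ketBra ψ)))) := by
  have hc : (Fintype.card ι : ℂ) ≠ 0 := by exact_mod_cast Fintype.card_ne_zero
  set T₀ : Matrix (S × M) (S × M) ℂ →ₗ[ℂ] Matrix (S × M) (S × M) ℂ :=
    ((Fintype.card ι : ℝ)⁻¹ : ℂ) •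
      ∑ j, dilatedMap (Matrix.diagonal fun c => (p c : ℂ)) (V j) with hT₀
  have hT₀k : ∀ A, T₀ A = ∑ k, krausOp p V k * A * (krausOp p V k)ᴴ := by
    intro A
    rw [sum_krausOp hp, hT₀, LinearMap.smul_apply, LinearMap.sum_apply]
    rfl
  have hT₀e : ∀ A, T₀ A = σ ⊗ₖ traceFst A := by
    intro A
    rw [hT₀, LinearMap.smul_apply, LinearMap.sum_apply, Finset.sum_congr rfl fun j _ => hV j A,
      Finset.sum_const, Finset.card_univ, ← Nat.cast_smul_eq_nsmul ℂ, smul_smul]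
    simp [hc]
  have hτ : Matrix.reindex (Equiv.prodAssoc S M R).symm (Equiv.prodAssoc S M R).symm
        (σ ⊗ₖ traceFst (Matrix.reindex (Equiv.prodAssoc S M R) (Equiv.prodAssoc S M R)
          (ketBra ψ))) = extendById R T₀ (ketBra ψ) := by
    ext ⟨⟨s, m⟩, r⟩ ⟨⟨s', m'⟩, r'⟩
    simp [extendById, hT₀e, traceFst]
  rw [hτ, extendById_ketBra_of_kraus hT, extendById_ketBra_of_kraus hT₀k]
  refine le_trans ?_ (re_trace_conjTranspose_mul_le_fidelity _ _)
  rw [trace_krausColumns_mul, sum_krausOp hp, Matrix.trace_smul, Matrix.trace_sum]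
  simp only [trace_traceSnd, Matrix.mul_assoc] at hδ ⊢
  rw [← Complex.ofReal_inv, smul_eq_mul, Complex.re_ofReal_mul, Complex.re_sum]
  have hs := Finset.card_nsmul_le_sum Finset.univ _ _ fun j (_ : j ∈ Finset.univ) => hδ j
  rw [nsmul_eq_mul, Finset.card_univ] at hs
  have hc' : (0 : ℝ) < Fintype.card ι := by exact_mod_cast Fintype.card_pos
  rw [inv_mul_eq_div, le_div_iff₀ hc', mul_comm]
  exact hs

theorem commute_kronecker_one_totalHamiltonian {X : Type*} [Fintype X] [DecidableEq X]
    {A HX : Matrix X X ℂ} (HB : Matrix B B ℂ) (h : Commute A HX) :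
    Commute (A ⊗ₖ (1 : Matrix B B ℂ)) (totalHamiltonian HX HB) := by
  refine Commute.add_right ?_ ?_
  · change _ * _ = _ * _
    rw [← Matrix.mul_kronecker_mul, ← Matrix.mul_kronecker_mul, h.eq]
  · change _ * _ = _ * _
    rw [← Matrix.mul_kronecker_mul, ← Matrix.mul_kronecker_mul]
    simp

theorem Commute.conjTranspose_of_unitary {Y : Type*} [Fintype Y] [DecidableEq Y]
    {V H : Matrix Y Y ℂ} (hV : V ∈ Matrix.unitaryGroup Y ℂ) (h : Commute V H) :
    Commute Vᴴ H := by
  have h1 : Vᴴ * V = 1 := Matrix.mem_unitaryGroup_iff'.mp hV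
  have h2 : V * Vᴴ = 1 := Matrix.mem_unitaryGroup_iff.mp hV
  calc Vᴴ * H = Vᴴ * (H * V) * Vᴴ := by
        rw [Matrix.mul_assoc, Matrix.mul_assoc H, h2, Matrix.mul_one]
    _ = H * Vᴴ := by rw [← h.eq, ← Matrix.mul_assoc, h1, Matrix.one_mul]

/-- Erasure by position-based decoding, from unitaries `V j` that exchange the system `S` with the
`j`-th of several copies of a thermal system in the bath. -/
theorem exists_erasure_of_exchange {ι : Type} [Fintype ι] [DecidableEq ι] [Nonempty ι] [Nonempty B]
    {β : ℝ} {HX : Matrix (S × M) (S × M) ℂ} {HB : Matrix B B ℂ} (hHB : HB.IsHermitian)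
    {σ : Matrix S S ℂ} {p : B → ℝ} (hp : ∀ c, 0 ≤ p c) (hp1 : ∑ c, p c = 1)
    (hγ : gibbsState β HB = Matrix.diagonal fun c => (p c : ℂ))
    {V : ι → Matrix ((S × M) × B) ((S × M) × B) ℂ} (hV : ∀ j, V j ∈ Matrix.unitaryGroup _ ℂ)
    (hVc : ∀ j, Commute (V j) (totalHamiltonian HX HB))
    (hV1 : ∀ j A, dilatedMap (Matrix.diagonal fun c => (p c : ℂ)) (V j) A = σ ⊗ₖ traceFst A)
    (hV2 : ∀ i j, i ≠ j → ∀ A,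
      dilatedMap (Matrix.diagonal fun c => (p c : ℂ)) ((V i)ᴴ * V j) A = σ ⊗ₖ traceFst A)
    {m : ℝ} (hm : Real.exp m = Fintype.card ι)
    {𝒮 : Set (Matrix (S × M) (S × M) ℂ)} (h𝒮 : ∀ ρ ∈ 𝒮, IsState ρ)
    {P : Matrix (S × M) (S × M) ℂ} (hP : P.PosSemidef) (hP1 : (1 - P).PosSemidef)
    (hPc : Commute P HX) {κ κ' : ℝ} (hκ' : 0 ≤ κ')
    (h1 : ∀ ρ ∈ 𝒮, 1 - κ ≤ (P * ρ).trace.re)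
    (h2 : ∀ ρ ∈ 𝒮, (P * (σ ⊗ₖ traceFst ρ)).trace.re ≤ κ' / Real.exp m) :
    ∃ Φ : Matrix ((S × M) × Option ι) ((S × M) × Option ι) ℂ →ₗ[ℂ]
        Matrix ((S × M) × Option ι) ((S × M) × Option ι) ℂ,
      IsThermalOperation β (totalHamiltonian HX (0 : Matrix (Option ι) (Option ι) ℂ)) Φ ∧
      IsUniversalConditionalErasure σ 𝒮 (κ + κ' / 2)
        (effectiveWorkProcess Φ (someProjector ι) (ketBra (Pi.single none 1))) := by
  set γ : Matrix B B ℂ := Matrix.diagonal fun c => (p c : ℂ) with hγd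
  have hγ0 : γ.PosSemidef := Matrix.PosSemidef.diagonal fun c => by simpa using hp c
  have hγ1 : γ.trace = 1 := by
    rw [hγd, Matrix.trace_diagonal, ← Complex.ofReal_sum, hp1, Complex.ofReal_one]
  have hPH : (P ⊗ₖ (1 : Matrix B B ℂ)).IsHermitian :=
    (hP.kronecker Matrix.PosSemidef.one).isHermitian
  obtain ⟨U, hU, hUc, hUG⟩ := exists_decoder_unitary (HX := HX) (HB := HB)
    (P := fun j => V j * (P ⊗ₖ (1 : Matrix B B ℂ)) * (V j)ᴴ) (V := V)
    (fun j => Matrix.isHermitian_mul_mul_conjTranspose _ hPH)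
    (fun j => ((hVc j).mul_left (commute_kronecker_one_totalHamiltonian HB hPc)).mul_left
      (Commute.conjTranspose_of_unitary (hV j) (hVc j))) hV hVc
  have hT := effectiveWorkProcess_dilatedMap hp U _ hUG
  refine ⟨dilatedMap γ U, ⟨B, inferInstance, inferInstance, inferInstance, HB, U, hHB, hU, hUc,
    fun A => by rw [hγ]; rfl⟩, isCompletelyPositive_of_kraus hT,
    isTraceNonincreasing_effectiveWorkProcess hγ0 hγ1 hU batteryState_someProjector_posSemidef
      batteryState_someProjector_trace none, fun ρ hρ R _ _ ψ hψ => ?_⟩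
  refine le_fidelity_extendById hp hV1 hT ψ fun j => ?_
  rw [hψ, ← sub_sub]
  exact le_re_trace_decoder hP hP1 hV hγ0 hγ1 (h𝒮 ρ hρ) hκ' (h1 ρ hρ)
    (fun i j hij => by rw [hV2 i j hij, ← hm]; exact h2 ρ hρ) j

end Erasure

/-! ### Thermal states in an energy eigenbasis -/

section Gibbs

variable {S : Type*} [Fintype S] [DecidableEq S]

/-- Boltzmann weights of the energy levels `μ`. -/
noncomputable def boltzmann (β : ℝ) (μ : S → ℝ) (s : S) : ℝ :=
  Real.exp (-β * μ s) / ∑ t, Real.exp (-β * μ t)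

theorem boltzmann_nonneg (β : ℝ) (μ : S → ℝ) (s : S) : 0 ≤ boltzmann β μ s := by
  unfold boltzmann; positivity

theorem sum_boltzmann [Nonempty S] (β : ℝ) (μ : S → ℝ) : ∑ s, boltzmann β μ s = 1 := by
  unfold boltzmann
  rw [← Finset.sum_div, div_self]
  exact (Finset.sum_pos (fun s _ => Real.exp_pos _) Finset.univ_nonempty).ne'

theorem sum_prod_pi {ι : Type*} [Fintype ι] [DecidableEq ι] {R : Type*} [CommSemiring R]
    (f : ι → S → R) : ∑ a : ι → S, ∏ i, f i (a i) = ∏ i, ∑ s, f i s := by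
  rw [Finset.prod_univ_sum, Fintype.piFinset_univ]

/-- Energies of the copies add, so the bath weights factor. -/
theorem boltzmann_pi {ι : Type*} [Fintype ι] [DecidableEq ι] (β : ℝ) (μ : S → ℝ) (a : ι → S) :
    boltzmann β (fun a : ι → S => ∑ i, μ (a i)) a = ∏ i, boltzmann β μ (a i) := by
  simp only [boltzmann, Finset.mul_sum, Real.exp_sum, Finset.prod_div_distrib]
  rw [sum_prod_pi fun (_ : ι) (s : S) => Real.exp (-β * μ s)]

theorem gibbsState_unitary_conj (β : ℝ) (μ : S → ℝ) {v : Matrix S S ℂ}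
    (hv : v ∈ Matrix.unitaryGroup S ℂ) :
    gibbsState β (v * Matrix.diagonal (fun s => (μ s : ℂ)) * vᴴ) =
      v * Matrix.diagonal (fun s => (boltzmann β μ s : ℂ)) * vᴴ := by
  have h1 : vᴴ * v = 1 := Matrix.mem_unitaryGroup_iff'.mp hv
  have h2 : v * vᴴ = 1 := Matrix.mem_unitaryGroup_iff.mp hv
  have hinv : v⁻¹ = vᴴ := Matrix.inv_eq_right_inv h2
  have hexp : NormedSpace.exp ((-β : ℂ) • (v * Matrix.diagonal (fun s => (μ s : ℂ)) * vᴴ)) =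
      v * Matrix.diagonal (fun s => (Real.exp (-β * μ s) : ℂ)) * vᴴ := by
    rw [← hinv, ← Matrix.smul_mul, ← Matrix.mul_smul,
      Matrix.exp_conj _ _ (IsUnit.of_mul_eq_one _ h2), ← Matrix.diagonal_smul, Matrix.exp_diagonal]
    congr 3
    ext s
    simp [Pi.coe_exp, Complex.exp_eq_exp_ℂ]
  have htr : (v * Matrix.diagonal (fun s => (Real.exp (-β * μ s) : ℂ)) * vᴴ).trace =
      ((∑ t, Real.exp (-β * μ t) : ℝ) : ℂ) := by
    rw [Matrix.trace_mul_comm, ← Matrix.mul_assoc, h1, Matrix.one_mul, Matrix.trace_diagonal]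
    push_cast
    rfl
  rw [gibbsState, hexp, htr, ← Matrix.smul_mul, ← Matrix.mul_smul, ← Matrix.diagonal_smul]
  congr 3
  ext s
  simp only [Pi.smul_apply, boltzmann, smul_eq_mul, Complex.ofReal_div]
  rw [div_eq_inv_mul]

end Gibbs

/-! ### Exchanging the system with a thermal copy -/

section Exchange

variable {S M ι : Type*} [Fintype S] [DecidableEq S] [Fintype M] [DecidableEq M]
  [Fintype ι] [DecidableEq ι]

/-- Exchange of the basis labels of the system `S` and of the `j`-th copy. -/
def exchange (j : ι) : Equiv.Perm ((S × M) × (ι → S)) :=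
  Function.Involutive.toPerm (fun y => ((y.2 j, y.1.2), Function.update y.2 j y.1.1))
    fun y => by simp

theorem exchange_apply (j : ι) (s : S) (m : M) (a : ι → S) :
    exchange j ((s, m), a) = ((a j, m), Function.update a j s) := rfl

theorem exchange_symm (j : ι) : (exchange j : Equiv.Perm ((S × M) × (ι → S))).symm = exchange j :=
  rfl

/-- The permutation matrix of `f`, conjugated by `v ⊗ 1 ⊗ 1`. -/
def conjPerm (v : Matrix S S ℂ) (f : Equiv.Perm ((S × M) × (ι → S))) :
    Matrix ((S × M) × (ι → S)) ((S × M) × (ι → S)) ℂ :=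
  ((v ⊗ₖ (1 : Matrix M M ℂ)) ⊗ₖ (1 : Matrix (ι → S) (ι → S) ℂ)) * f.toPEquiv.toMatrix *
    ((v ⊗ₖ (1 : Matrix M M ℂ)) ⊗ₖ (1 : Matrix (ι → S) (ι → S) ℂ))ᴴ

theorem kronecker_one_mem_unitaryGroup {X Y : Type*} [Fintype X] [DecidableEq X] [Fintype Y]
    [DecidableEq Y] {v : Matrix X X ℂ} (hv : v ∈ Matrix.unitaryGroup X ℂ) :
    v ⊗ₖ (1 : Matrix Y Y ℂ) ∈ Matrix.unitaryGroup (X × Y) ℂ :=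
  Matrix.kronecker_mem_unitary hv (one_mem _)

theorem conjTranspose_toMatrix_toPEquiv {Y : Type*} [Fintype Y] [DecidableEq Y]
    (f : Equiv.Perm Y) :
    (f.toPEquiv.toMatrix : Matrix Y Y ℂ)ᴴ = f.symm.toPEquiv.toMatrix := by
  ext y y'
  simp [PEquiv.toMatrix_apply, Equiv.toPEquiv_apply, Equiv.eq_symm_apply, eq_comm]

theorem conjTranspose_conjPerm (v : Matrix S S ℂ) (f : Equiv.Perm ((S × M) × (ι → S))) :
    (conjPerm v f)ᴴ = conjPerm v f.symm := by
  simp only [conjPerm, Matrix.conjTranspose_mul, Matrix.conjTranspose_conjTranspose,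
    conjTranspose_toMatrix_toPEquiv, Matrix.mul_assoc]

theorem conjPerm_mul_conjPerm {v : Matrix S S ℂ} (hv : v ∈ Matrix.unitaryGroup S ℂ)
    (f g : Equiv.Perm ((S × M) × (ι → S))) :
    conjPerm v f * conjPerm v g = conjPerm v (f.trans g) := by
  have hD := Matrix.mem_unitaryGroup_iff'.mp (kronecker_one_mem_unitaryGroup (Y := ι → S)
    (kronecker_one_mem_unitaryGroup (Y := M) hv))
  rw [Matrix.star_eq_conjTranspose] at hD
  simp only [conjPerm, Equiv.toPEquiv_trans, PEquiv.toMatrix_trans]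
  generalize (v ⊗ₖ (1 : Matrix M M ℂ)) ⊗ₖ (1 : Matrix (ι → S) (ι → S) ℂ) = D at hD ⊢
  calc _ = D * f.toPEquiv.toMatrix * (Dᴴ * D) * g.toPEquiv.toMatrix * Dᴴ := by
        simp only [Matrix.mul_assoc]
    _ = _ := by rw [hD, Matrix.mul_one]; simp only [Matrix.mul_assoc]

theorem conjPerm_mem_unitaryGroup {v : Matrix S S ℂ} (hv : v ∈ Matrix.unitaryGroup S ℂ)
    (f : Equiv.Perm ((S × M) × (ι → S))) : conjPerm v f ∈ Matrix.unitaryGroup _ ℂ := by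
  have hD := Matrix.mem_unitaryGroup_iff.mp (kronecker_one_mem_unitaryGroup (Y := ι → S)
    (kronecker_one_mem_unitaryGroup (Y := M) hv))
  rw [Matrix.star_eq_conjTranspose] at hD
  rw [Matrix.mem_unitaryGroup_iff, Matrix.star_eq_conjTranspose, conjTranspose_conjPerm,
    conjPerm_mul_conjPerm hv, Equiv.self_trans_symm, conjPerm]
  simp [hD]

theorem totalHamiltonian_conj {X Y : Type*} [Fintype X] [DecidableEq X] [Fintype Y]
    [DecidableEq Y] {w : Matrix X X ℂ} (hw : w ∈ Matrix.unitaryGroup X ℂ) (HX : Matrix X X ℂ)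
    (HY : Matrix Y Y ℂ) :
    (w ⊗ₖ (1 : Matrix Y Y ℂ)) * totalHamiltonian HX HY * (w ⊗ₖ (1 : Matrix Y Y ℂ))ᴴ =
      totalHamiltonian (w * HX * wᴴ) HY := by
  have h : w * wᴴ = 1 := Matrix.mem_unitaryGroup_iff.mp hw
  rw [totalHamiltonian, Matrix.mul_add, Matrix.add_mul, Matrix.conjTranspose_kronecker,
    ← Matrix.mul_kronecker_mul, ← Matrix.mul_kronecker_mul, ← Matrix.mul_kronecker_mul,
    ← Matrix.mul_kronecker_mul]
  simp [totalHamiltonian, h]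

theorem commute_exchange (μ : S → ℂ) (HM : Matrix M M ℂ) (j : ι) :
    Commute ((exchange j : Equiv.Perm ((S × M) × (ι → S))).toPEquiv.toMatrix : Matrix _ _ ℂ)
      (totalHamiltonian (totalHamiltonian (Matrix.diagonal μ) HM)
        (Matrix.diagonal fun a : ι → S => ∑ i, μ (a i))) := by
  change _ * _ = _ * _
  rw [PEquiv.toMatrix_toPEquiv_mul, PEquiv.mul_toMatrix_toPEquiv, exchange_symm]
  ext ⟨⟨s, m⟩, a⟩ ⟨⟨s', m'⟩, a'⟩
  simp only [Matrix.submatrix_apply, id_eq, exchange_apply]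
  -- A matrix entry of the total Hamiltonian vanishes unless the labels of `S` and of the bath
  -- agree; this makes the two supports coincide. On the support, the exchange only permutes the
  -- summands of the energy.
  have hiff : (a j = s' ∧ Function.update a j s = a') ↔
      (s = a' j ∧ a = Function.update a' j s') := by
    constructor
    · rintro ⟨rfl, rfl⟩
      simp
    · rintro ⟨rfl, rfl⟩
      simp
  by_cases h : a j = s' ∧ Function.update a j s = a'
  · obtain ⟨rfl, rfl⟩ := h
    have hs : μ (a j) + ∑ i, μ (Function.update a j s i) = μ s + ∑ i, μ (a i) := by
      rw [← Finset.add_sum_erase _ _ (Finset.mem_univ j),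
        ← Finset.add_sum_erase _ (fun i => μ (a i)) (Finset.mem_univ j), Function.update_self,
        Finset.sum_congr rfl fun i hi => by
          rw [Function.update_of_ne (Finset.ne_of_mem_erase hi)]]
      ring
    simp [totalHamiltonian, Matrix.one_apply]
    split_ifs
    · linear_combination hs
    · rfl
  · have h' := mt hiff.mpr h
    simp only [totalHamiltonian, Matrix.add_apply, Matrix.kroneckerMap_apply, Matrix.one_apply,
      Matrix.diagonal_apply]
    split_ifs <;> simp_all

/-- The copies are already written in their energy eigenbasis, so rotating `S` alone by `v` reduces
to the diagonal case. -/
theorem commute_conjPerm_exchange {v : Matrix S S ℂ} (hv : v ∈ Matrix.unitaryGroup S ℂ)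
    (μ : S → ℂ) (HM : Matrix M M ℂ) (j : ι) :
    Commute (conjPerm v (exchange j))
      (totalHamiltonian (totalHamiltonian (v * Matrix.diagonal μ * vᴴ) HM)
        (Matrix.diagonal fun a : ι → S => ∑ i, μ (a i))) := by
  have hw := kronecker_one_mem_unitaryGroup (Y := M) hv
  have hD := Matrix.mem_unitaryGroup_iff'.mp (kronecker_one_mem_unitaryGroup (Y := ι → S) hw)
  have hc := commute_exchange μ HM j
  rw [Matrix.star_eq_conjTranspose] at hD
  rw [← totalHamiltonian_conj hv, ← totalHamiltonian_conj hw, conjPerm]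
  generalize (v ⊗ₖ (1 : Matrix M M ℂ)) ⊗ₖ (1 : Matrix (ι → S) (ι → S) ℂ) = D at hD ⊢
  generalize totalHamiltonian (totalHamiltonian (Matrix.diagonal μ) HM)
    (Matrix.diagonal fun a : ι → S => ∑ i, μ (a i)) = H at hc ⊢
  generalize ((exchange j : Equiv.Perm ((S × M) × (ι → S))).toPEquiv.toMatrix : Matrix _ _ ℂ) = Q
    at hc ⊢
  calc D * Q * Dᴴ * (D * H * Dᴴ) = D * Q * (Dᴴ * D) * H * Dᴴ := by simp only [Matrix.mul_assoc]
    _ = D * H * Q * Dᴴ := by rw [hD, Matrix.mul_one, Matrix.mul_assoc D, hc.eq, ← Matrix.mul_assoc]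
    _ = D * H * (Dᴴ * D) * Q * Dᴴ := by rw [hD, Matrix.mul_one]
    _ = _ := by simp only [Matrix.mul_assoc]

theorem kronecker_one_conj {X Y : Type*} [Fintype X] [DecidableEq X] [Fintype Y] [DecidableEq Y]
    (w A : Matrix X X ℂ) (γ : Matrix Y Y ℂ) :
    (w ⊗ₖ (1 : Matrix Y Y ℂ))ᴴ * (A ⊗ₖ γ) * (w ⊗ₖ (1 : Matrix Y Y ℂ)) = (wᴴ * A * w) ⊗ₖ γ := by
  rw [Matrix.conjTranspose_kronecker, ← Matrix.mul_kronecker_mul, ← Matrix.mul_kronecker_mul]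
  simp

theorem traceSnd_conj {X Y : Type*} [Fintype X] [DecidableEq X] [Fintype Y] [DecidableEq Y]
    (w : Matrix X X ℂ) (Q : Matrix (X × Y) (X × Y) ℂ) :
    traceSnd ((w ⊗ₖ (1 : Matrix Y Y ℂ)) * Q * (w ⊗ₖ (1 : Matrix Y Y ℂ))ᴴ) =
      w * traceSnd Q * wᴴ := by
  ext x x'
  simp [traceSnd, Matrix.mul_apply, Fintype.sum_prod_type, Matrix.one_apply, Finset.sum_mul,
    Finset.mul_sum, apply_ite (starRingEnd ℂ)]
  rw [Finset.sum_comm]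
  refine Finset.sum_congr rfl fun y' _ => ?_
  rw [Finset.sum_comm]

theorem traceFst_conj {v : Matrix S S ℂ} (hv : v ∈ Matrix.unitaryGroup S ℂ)
    (A : Matrix (S × M) (S × M) ℂ) :
    traceFst ((v ⊗ₖ (1 : Matrix M M ℂ))ᴴ * A * (v ⊗ₖ (1 : Matrix M M ℂ))) = traceFst A := by
  have h : v * vᴴ = 1 := Matrix.mem_unitaryGroup_iff.mp hv
  ext m m'
  have e : (vᴴ * (Matrix.of fun s s' => A (s, m) (s', m')) * v).trace =
      (Matrix.of fun s s' => A (s, m) (s', m')).trace := by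
    rw [Matrix.trace_mul_comm, ← Matrix.mul_assoc, h, Matrix.one_mul]
  simp only [Matrix.trace, Matrix.diag_apply, Matrix.of_apply] at e
  rw [traceFst, traceFst, Matrix.of_apply, Matrix.of_apply, ← e]
  refine Finset.sum_congr rfl fun s _ => ?_
  simp [Matrix.mul_apply, Fintype.sum_prod_type, Matrix.one_apply, apply_ite (starRingEnd ℂ)]

/-- All coordinates but the `j`-th are independent with total weight one and sum out. -/
theorem sum_apply_mul_prod_erase {R : Type*} [CommSemiring R] {p : S → R} (hp : ∑ s, p s = 1)
    (F : S → R) (j : ι) :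
    ∑ a : ι → S, F (a j) * ∏ k ∈ Finset.univ.erase j, p (a k) = ∑ s, F s := by
  have h : ∀ a : ι → S, F (a j) * ∏ k ∈ Finset.univ.erase j, p (a k) =
      ∏ k, (if k = j then F else p) (a k) := by
    intro a
    rw [← Finset.mul_prod_erase _ _ (Finset.mem_univ j), if_pos rfl]
    congr 1
    exact Finset.prod_congr rfl fun k hk => by rw [if_neg (Finset.ne_of_mem_erase hk)]
  simp only [h]
  rw [sum_prod_pi fun (k : ι) (s : S) => (if k = j then F else p) s,
    ← Finset.mul_prod_erase _ _ (Finset.mem_univ j)]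
  rw [Finset.prod_congr rfl fun k hk => by
    rw [if_neg (Finset.ne_of_mem_erase hk), hp]]
  simp

/-- A permutation that moves the label of the `j`-th copy into the system, and the label of the
system into the product weights of the copies, replaces the state of the system. -/
theorem dilatedMap_conjPerm {v : Matrix S S ℂ} (hv : v ∈ Matrix.unitaryGroup S ℂ) {p : S → ℝ}
    (hp : ∑ s, p s = 1) (f : Equiv.Perm ((S × M) × (ι → S))) (j : ι) (h : S → (ι → S) → ι → S)
    (hf : ∀ s m a, f ((s, m), a) = ((a j, m), h s a))
    (hh : ∀ s s' a, h s a = h s' a → s = s')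
    (hprod : ∀ s a, ∏ k, p (h s a k) = p s * ∏ k ∈ Finset.univ.erase j, p (a k))
    (A : Matrix (S × M) (S × M) ℂ) :
    dilatedMap (Matrix.diagonal fun a => ((∏ k, p (a k) : ℝ) : ℂ)) (conjPerm v f) A =
      (v * Matrix.diagonal (fun s => (p s : ℂ)) * vᴴ) ⊗ₖ traceFst A := by
  set w := v ⊗ₖ (1 : Matrix M M ℂ) with hw
  set γ : Matrix (ι → S) (ι → S) ℂ := Matrix.diagonal fun a => ((∏ k, p (a k) : ℝ) : ℂ) with hγ
  have e1 : dilatedMap γ (conjPerm v f) A =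
      w * traceSnd (((wᴴ * A * w) ⊗ₖ γ).submatrix f f) * wᴴ := by
    rw [← traceSnd_conj]
    change traceSnd _ = _
    congr 1
    have : ((wᴴ * A * w) ⊗ₖ γ).submatrix f f =
        f.toPEquiv.toMatrix * ((wᴴ * A * w) ⊗ₖ γ) * (f.toPEquiv.toMatrix)ᴴ := by
      rw [conjTranspose_toMatrix_toPEquiv, PEquiv.toMatrix_toPEquiv_mul,
        PEquiv.mul_toMatrix_toPEquiv]
      rfl
    rw [this, ← kronecker_one_conj w A γ, conjPerm, ← hw]
    simp only [Matrix.conjTranspose_mul, Matrix.conjTranspose_conjTranspose, Matrix.mul_assoc]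
  have e2 : traceSnd (((wᴴ * A * w) ⊗ₖ γ).submatrix f f) =
      Matrix.diagonal (fun s => (p s : ℂ)) ⊗ₖ traceFst A := by
    rw [← traceFst_conj hv A, ← hw]
    ext ⟨s, m⟩ ⟨s', m'⟩
    simp only [traceSnd, Matrix.of_apply, Matrix.submatrix_apply, hf, Matrix.kroneckerMap_apply,
      traceFst, hγ]
    -- For `s = s'`, summing over the label `a j` yields the partial trace of `A`. For `s ≠ s'`, the
    -- bath labels differ by injectivity of `h`, and the diagonal bath state gives zero.
    rcases eq_or_ne s s' with rfl | hs
    · simp only [Matrix.diagonal_apply_eq, hprod]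
      rw [← sum_apply_mul_prod_erase (p := fun s => (p s : ℂ)) (by exact_mod_cast hp)
        (fun s => (wᴴ * A * w) (s, m) (s, m')) j, Finset.mul_sum]
      refine Finset.sum_congr rfl fun a _ => ?_
      push_cast
      ring
    · have : ∀ a, h s a ≠ h s' a := fun a ha => hs (hh _ _ _ ha)
      simp [Matrix.diagonal_apply_ne _ hs, Matrix.diagonal_apply_ne _ (this _)]
  rw [e1, e2, hw, Matrix.conjTranspose_kronecker, ← Matrix.mul_kronecker_mul,
    ← Matrix.mul_kronecker_mul]
  simp

end Exchange

/-- For `i ≠ j` the two exchanges compose to a three-cycle of labels: copy `j` to the system, the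
system to copy `i`, copy `i` to copy `j`. It still meets the conditions of `dilatedMap_conjPerm`. -/
theorem exchange_trans_exchange_apply {S M ι : Type*} [Fintype S] [DecidableEq S] [Fintype M]
    [DecidableEq M] [Fintype ι] [DecidableEq ι] {i j : ι} (hij : i ≠ j)
    (s : S) (m : M) (a : ι → S) :
    ((exchange i).trans (exchange j) : Equiv.Perm ((S × M) × (ι → S))) ((s, m), a) =
      ((a j, m), Function.update (Function.update a i s) j (a i)) := by
  change ((Function.update a i s j, m), Function.update (Function.update a i s) j (a i)) = _
  rw [Function.update_of_ne hij.symm]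

theorem prod_update_apply {S ι : Type*} [Fintype ι] [DecidableEq ι] (p : S → ℝ) (j : ι) (s : S)
    (a : ι → S) :
    ∏ k, p (Function.update a j s k) = p s * ∏ k ∈ Finset.univ.erase j, p (a k) := by
  rw [← Finset.mul_prod_erase _ _ (Finset.mem_univ j), Function.update_self]
  congr 1
  exact Finset.prod_congr rfl fun k hk => by
    rw [Function.update_of_ne (Finset.ne_of_mem_erase hk)]

theorem prod_update_update_apply {S ι : Type*} [Fintype ι] [DecidableEq ι] (p : S → ℝ) {i j : ι}
    (hij : i ≠ j) (s : S) (a : ι → S) :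
    ∏ k, p (Function.update (Function.update a i s) j (a i) k) =
      p s * ∏ k ∈ Finset.univ.erase j, p (a k) := by
  have hi : i ∈ Finset.univ.erase j := Finset.mem_erase.mpr ⟨hij, Finset.mem_univ _⟩
  rw [prod_update_apply, ← Finset.mul_prod_erase _ _ hi,
    ← Finset.mul_prod_erase _ (fun k => p (a k)) hi, Function.update_self,
    Finset.prod_congr rfl fun k hk => by
      rw [Function.update_of_ne (Finset.ne_of_mem_erase hk)]]
  ring

/-- A test that tells `ρ` from `γ_S ⊗ ρ_M`, for all `ρ` in a set of states, gives an erasure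
process for that set. -/
theorem exists_erasure {S M : Type u} [Fintype S] [DecidableEq S] [Fintype M] [DecidableEq M]
    {β : ℝ} {HS : Matrix S S ℂ} {HM : Matrix M M ℂ} (hHS : HS.IsHermitian)
    {ι : Type} [Fintype ι] [DecidableEq ι] [Nonempty ι] {m : ℝ} (hm : Real.exp m = Fintype.card ι)
    {𝒮 : Set (Matrix (S × M) (S × M) ℂ)} (h𝒮 : ∀ ρ ∈ 𝒮, IsState ρ)
    {P : Matrix (S × M) (S × M) ℂ} (hP : P.PosSemidef) (hP1 : (1 - P).PosSemidef)
    (hPc : Commute P (totalHamiltonian HS HM)) {κ κ' : ℝ} (hκ' : 0 ≤ κ')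
    (h1 : ∀ ρ ∈ 𝒮, 1 - κ ≤ (P * ρ).trace.re)
    (h2 : ∀ ρ ∈ 𝒮, (P * (gibbsState β HS ⊗ₖ traceFst ρ)).trace.re ≤ κ' / Real.exp m) :
    ∃ Φ : Matrix ((S × M) × Option ι) ((S × M) × Option ι) ℂ →ₗ[ℂ]
        Matrix ((S × M) × Option ι) ((S × M) × Option ι) ℂ,
      IsThermalOperation β
        (totalHamiltonian (totalHamiltonian HS HM) (0 : Matrix (Option ι) (Option ι) ℂ)) Φ ∧
      IsUniversalConditionalErasure (gibbsState β HS) 𝒮 (κ + κ' / 2)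
        (effectiveWorkProcess Φ (someProjector ι) (ketBra (Pi.single none 1))) := by
  rcases isEmpty_or_nonempty S with hS | hS
  -- For empty `S` the bath `ι → S` would be empty too, which is not allowed; a one-point bath
  -- works, as all operators on `S × M` are trivial.
  · refine exists_erasure_of_exchange (B := PUnit.{u + 1}) (HB := 0) (p := fun _ => 1)
      (V := fun _ => 1) Matrix.isHermitian_zero (fun _ => zero_le_one) (by simp) ?_
      (fun _ => one_mem _) (fun _ => Commute.one_left _) (fun _ A => ?_) (fun _ _ _ A => ?_) hm h𝒮
      hP hP1 hPc hκ' h1 h2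
    · have := gibbsState_unitary_conj β (fun _ : PUnit.{u + 1} => 0) (one_mem _)
      simpa [boltzmann] using this
    · ext ⟨s, _⟩
      exact hS.elim s
    · ext ⟨s, _⟩
      exact hS.elim s
  · obtain ⟨v, μ, hv, rfl⟩ : ∃ (v : Matrix S S ℂ) (μ : S → ℝ), v ∈ Matrix.unitaryGroup S ℂ ∧
        HS = v * Matrix.diagonal (fun s => (μ s : ℂ)) * vᴴ :=
      ⟨hHS.eigenvectorUnitary, hHS.eigenvalues, hHS.eigenvectorUnitary.2, hHS.spectral_theorem⟩
    rw [gibbsState_unitary_conj β μ hv] at h2 ⊢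
    have hp1 := sum_boltzmann β μ
    have hγ : gibbsState β (Matrix.diagonal fun a : ι → S => ∑ i, (μ (a i) : ℂ)) =
        Matrix.diagonal fun a => ((∏ i, boltzmann β μ (a i) : ℝ) : ℂ) := by
      have := gibbsState_unitary_conj β (fun a : ι → S => ∑ i, μ (a i)) (one_mem _)
      simp only [Matrix.one_mul, Matrix.conjTranspose_one, Matrix.mul_one, boltzmann_pi,
        Complex.ofReal_sum] at this
      exact this
    have hHB : (Matrix.diagonal fun a : ι → S => ∑ i, (μ (a i) : ℂ)).IsHermitian := by
      refine Matrix.isHermitian_diagonal_iff.mpr fun a => ?_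
      simp [isSelfAdjoint_iff]
    have hVc : ∀ j, Commute (conjPerm (M := M) v (exchange j)) (totalHamiltonian
        (totalHamiltonian (v * Matrix.diagonal (fun s => (μ s : ℂ)) * vᴴ) HM)
        (Matrix.diagonal fun a : ι → S => ∑ i, (μ (a i) : ℂ))) :=
      fun j => commute_conjPerm_exchange hv (fun s => (μ s : ℂ)) HM j
    refine exists_erasure_of_exchange (B := ι → S)
      (HB := Matrix.diagonal fun a : ι → S => ∑ i, (μ (a i) : ℂ))
      (p := fun a => ∏ i, boltzmann β μ (a i)) (V := fun j => conjPerm v (exchange j)) hHB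
      (fun a => Finset.prod_nonneg fun i _ => boltzmann_nonneg β μ _) ?_ hγ
      (fun j => conjPerm_mem_unitaryGroup hv _) hVc (fun j A => ?_) (fun i j hij A => ?_) hm h𝒮
      hP hP1 hPc hκ' h1 h2
    · rw [sum_prod_pi fun (_ : ι) (s : S) => boltzmann β μ s, hp1, Finset.prod_const_one]
    · exact dilatedMap_conjPerm hv hp1 _ j (fun s a => Function.update a j s)
        (fun s m a => exchange_apply j s m a)
        (fun s s' a h => by simpa using congr_fun h j) (fun s a => prod_update_apply _ j s a) A
    -- Exchanges are involutions, so `(V i)† V j` is again a conjugated permutation.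
    · rw [conjTranspose_conjPerm, exchange_symm, conjPerm_mul_conjPerm hv]
      exact dilatedMap_conjPerm hv hp1 _ j
        (fun s a => Function.update (Function.update a i s) j (a i))
        (fun s m a => exchange_trans_exchange_apply hij s m a)
        (fun s s' a h => by simpa [Function.update_of_ne hij] using congr_fun h i)
        (fun s a => prod_update_update_apply _ hij s a) A

/-- The hypotheses on the test are convex in the state. -/
theorem convex_setOf_test {S M : Type*} [Fintype S] [DecidableEq S] [Fintype M] [DecidableEq M]
    (P : Matrix (S × M) (S × M) ℂ) (σ : Matrix S S ℂ) (c c' : ℝ) :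
    Convex ℝ {ρ : Matrix (S × M) (S × M) ℂ | IsState ρ ∧ c ≤ (P * ρ).trace.re ∧
      (P * (σ ⊗ₖ traceFst ρ)).trace.re ≤ c'} := by
  rintro ρ ⟨⟨hρ, hρ1⟩, h1, h2⟩ ω ⟨⟨hω, hω1⟩, k1, k2⟩ a b ha hb hab
  have e : σ ⊗ₖ traceFst (a • ρ + b • ω) = a • (σ ⊗ₖ traceFst ρ) + b • (σ ⊗ₖ traceFst ω) := by
    ext ⟨s, m⟩ ⟨s', m'⟩
    simp [traceFst, Finset.sum_add_distrib, Finset.mul_sum, mul_add]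
    simp only [mul_left_comm]
  refine ⟨⟨(hρ.smul ha).add (hω.smul hb), ?_⟩, ?_, ?_⟩
  · rw [Matrix.trace_add, Matrix.trace_smul, Matrix.trace_smul, hρ1, hω1, ← add_smul, hab, one_smul]
  · rw [Matrix.mul_add, Matrix.trace_add, Matrix.mul_smul, Matrix.mul_smul, Matrix.trace_smul,
      Matrix.trace_smul, Complex.add_re, Complex.smul_re, Complex.smul_re, smul_eq_mul, smul_eq_mul]
    have hc : c = a * c + b * c := by rw [← add_mul, hab, one_mul]
    linarith [mul_le_mul_of_nonneg_left h1 ha, mul_le_mul_of_nonneg_left k1 hb]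
  · rw [e, Matrix.mul_add, Matrix.trace_add, Matrix.mul_smul, Matrix.mul_smul, Matrix.trace_smul,
      Matrix.trace_smul, Complex.add_re, Complex.smul_re, Complex.smul_re, smul_eq_mul, smul_eq_mul]
    have hc : c' = a * c' + b * c' := by rw [← add_mul, hab, one_mul]
    linarith [mul_le_mul_of_nonneg_left h2 ha, mul_le_mul_of_nonneg_left k2 hb]

end QThermo

/-! ### The proposition -/

theorem mainTheorem6 {S M : Type u} [Fintype S] [DecidableEq S] [Fintype M] [DecidableEq M]
    (β : ℝ) (HS : Matrix S S ℂ) (HM : Matrix M M ℂ) (hHS : HS.IsHermitian) (hHM : HM.IsHermitian)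
    (𝒮 : Set (Matrix (S × M) (S × M) ℂ)) (h𝒮 : ∀ ρ ∈ 𝒮, IsState ρ)
    (m : ℝ) (hm : 0 ≤ m) (hm_int : ∃ N : ℕ, Real.exp m = N)
    (P : Matrix (S × M) (S × M) ℂ) (hP_nonneg : P.PosSemidef) (hP_le_one : (1 - P).PosSemidef)
    (hP_comm : Commute P (totalHamiltonian HS HM))
    (κ κ' : ℝ) (hκ : 0 ≤ κ) (hκ' : 0 ≤ κ')
    (hP_accept : ∀ ρ ∈ 𝒮, 1 - κ ≤ (P * ρ).trace.re)
    (hP_reject : ∀ ρ ∈ 𝒮,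
      (P * (gibbsState β HS ⊗ₖ traceFst ρ)).trace.re ≤ κ' / Real.exp m) :
    ∃ (J : Type) (_ : Fintype J) (_ : DecidableEq J) (j₀ : J) (PJ : Matrix J J ℂ)
      (Φ : Matrix ((S × M) × J) ((S × M) × J) ℂ →ₗ[ℂ] Matrix ((S × M) × J) ((S × M) × J) ℂ),
      IsBatteryProjector m PJ ∧
      IsThermalOperation β (totalHamiltonian (totalHamiltonian HS HM) (0 : Matrix J J ℂ)) Φ ∧
      IsUniversalConditionalErasure (gibbsState β HS) (convexHull ℝ 𝒮) (2 * κ + 4 * κ')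
        (effectiveWorkProcess Φ PJ (ketBra (Pi.single j₀ 1))) := by
  obtain ⟨N, hN⟩ := hm_int
  have hN0 : N ≠ 0 := by
    rintro rfl
    exact (Real.exp_pos m).ne' (by rw [hN, Nat.cast_zero])
  have : Nonempty (Fin N) := ⟨⟨0, Nat.pos_of_ne_zero hN0⟩⟩
  have hcard : Real.exp m = Fintype.card (Fin N) := by rw [hN, Fintype.card_fin]
  have hsub : 𝒮 ⊆ {ρ | IsState ρ ∧ 1 - κ ≤ (P * ρ).trace.re ∧
      (P * (gibbsState β HS ⊗ₖ traceFst ρ)).trace.re ≤ κ' / Real.exp m} :=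
    fun ρ hρ => ⟨h𝒮 ρ hρ, hP_accept ρ hρ, hP_reject ρ hρ⟩
  -- The states that pass both tests form a convex set containing `𝒮`, hence its hull; the
  -- construction is then run on the hull itself.
  have hull := convexHull_min hsub (convex_setOf_test P (gibbsState β HS) (1 - κ) _)
  obtain ⟨Φ, hΦ, hcp, htr, hF⟩ := exists_erasure (β := β) hHS hcard
    (fun ρ hρ => (hull hρ).1) hP_nonneg hP_le_one hP_comm hκ'
    (fun ρ hρ => (hull hρ).2.1) (fun ρ hρ => (hull hρ).2.2)
  refine ⟨Option (Fin N), inferInstance, inferInstance, none, someProjector (Fin N), Φ,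
    isBatteryProjector_someProjector hcard, hΦ, hcp, htr, fun ρ hρ R _ _ ψ hψ => ?_⟩
  -- The error obtained is `κ + κ'/2`, which nonnegativity of `κ` and `κ'` places below `2κ + 4κ'`.
  exact le_trans (by linarith) (hF ρ hρ R ψ hψ)
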